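/- **Edge colored hypergraphs.** Let $\ell\ge 0$ and let $\Lambda$ be a finite set of colors. For each color $c\in\Lambda$ let a set $\mathcal C^{-1}(c)$ of subsets of $\{1,\dots,\ell\}$ with at least two elements (the edges of color $c$) be given, and let $$X_c=\{v\in\mathbb C^\ell : v_i=v_j \text{ whenever } i,j \text{ lie in a common edge of color } c\}.$$ For $\Gamma\subseteq\Lambda$ put $\mathcal C^{-1}(\Gamma)=\bigcup_{c\in\Gamma}\mathcal C^{-1}(c)$ and $X_\Gamma=\bigcap_{c\in\Gamma}X_c$. Write $\Gamma\Subset\Gamma'$ if the vertex set of every connected component of $\mathcal C^{-1}(\Gamma)$ is contained in the vertex set of a connected component of $\mathcal C^{-1}(\Gamma')$, and call $\Gamma,\Gamma'$ multiplicative if $\operatorname{codim}X_\Gamma+\operatorname{codim}X_{\Gamma'}=\operatorname{codim}X_{\Gamma\cup\Gamma'}$. Assume that $\mathcal A=\{X_c\}_{c\in\Lambda}$ is a subspace arrangement: every $X_c$ is a proper subspace, and $\{c\}\Subset\{c'\}$ never holds for $c\ne c'$. **Massey color systems.** $(\lambda_1,\lambda_2,\lambda_3)$ is a Massey color system with embedded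 colors $\lambda_4,\lambda_5$ if the pairs $\{\lambda_1\},\{\lambda_2\}$ and $\{\lambda_1,\lambda_2\},\{\lambda_3\}$ are multiplicative and $$\{\lambda_4\}\Subset\{\lambda_1,\lambda_2\},\quad \{\lambda_1\}\not\Subset\{\lambda_2,\lambda_4\},\quad \{\lambda_2\}\not\Subset\{\lambda_1,\lambda_4\},$$ $$\{\lambda_5\}\Subset\{\lambda_2,\lambda_3\},\quad \{\lambda_2\}\not\Subset\{\lambda_3,\lambda_5\},\quad \{\lambda_3\}\not\Subset\{\lambda_2,\lambda_5\}.$$ **The relative atomic complex.** Fix a linear order $\ll$ on $\Lambda$. $D_{\mathcal A}$ is the commutative differential graded $\mathbb Q$-algebra with basis $a_\sigma$ ($\sigma\subseteq\Lambda$), where $|a_\sigma|=2\operatorname{codim}X_\sigma-|\sigma|$. For $\sigma=\{i_1\ll\dots\ll i_n\}$, $$d a_\sigma=\sum_{j:\,X_{\sigma\setminus\{i_j\}}=X_\sigma}(-1)^j a_{\sigma\setminus\{i_j\}};$$ moreover $a_\sigma a_\tau=\operatorname{sgn}(\epsilon)\,a_{\sigma\cup\tau}$ if $\sigma,\tau$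 are multiplicative, where $\epsilon$ is the permutation sorting the elements of $\sigma$ followed by those of $\tau$ (each in increasing order), and $a_\sigma a_\tau=0$ otherwise. The unit is $a_\emptyset$, and the augmentation ideal $\overline D_{\mathcal A}$ is spanned by the $a_\sigma$ with $\sigma\neq\emptyset$. **The Sinha–Walter spectral sequence.** For an augmented commutative differential graded algebra $W$ with augmentation ideal $\overline W$ and desuspension $s^{-1}\overline W$ (a label $a\in\overline W$ has degree $|a|-1$), let $\mathbb E(s^{-1}\overline W)=\bigoplus_{n\ge1}(\mathrm{Gr}(n)/{\sim})\otimes_{\Sigma_n}(s^{-1}\overline W)^{\otimes n}$. Here $\mathrm{Gr}(n)$ is the $\mathbb Q$-vector space spanned by the directed trees with vertex set $\{1,\dots,n\}$; the relation $\sim$ says that reversing an arrow changes the sign, and that the Arnold identity holds, i.e. three trees which differ only in containing the arrows $a\to b\to c$, resp. $b\to c\to a$, resp. $c\to a\to b$ have sum $0$; and $\Sigma_n$ acts on tensors with Koszul signs. The differential is $D=d_W+d_\mu$: $d_W$ is the extension of the differential $d$ of $W$ to a (graded) derivation on labels, and $d_\mu$ is the sum over all edges of the contraction of that edge, where for an edge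 from a vertex with label $a$ to one with label $b$ the two labels are moved to the front, replaced by $(-1)^{|a|}ab$ and the product is moved back to the place of $a$ (with Koszul signs). The tree $1\to2\to\dots\to n$ with labels $a_1,\dots,a_n$ is written $a_1|\cdots|a_n$. Let $F_p$ be spanned by the labelled trees with at most $p$ edges. The Sinha–Walter spectral sequence of $W$ is the spectral sequence of this filtration: with $Z^r_p=\{x\in F_p: Dx\in F_{p-r}\}$, $$E_r^p=Z^r_p\big/\big(Z^{r-1}_{p-1}+D Z^{r-1}_{p+r-1}\big),\qquad d_r:E_r^p\to E_r^{p-r},\quad [x]\mapsto[Dx].$$ An element $x\in F_p$ survives to $E_r$ if it is congruent modulo $F_{p-1}$ to an element of $Z^r_p$; it then represents the (unique) class of such an element in $E_r^p$. **Theorem.** Let $(\lambda_1,\lambda_2,\lambda_3)$ be a Massey color system with embedded colors $\lambda_4,\lambda_5$, and assume $\lambda_1\ll\lambda_2\ll\lambda_3\ll\lambda_4\ll\lambda_5$. Then in the Sinha–Walter spectral sequence of $D_{\mathcal A}$ the element $a_{\{\lambda_1\}}|a_{\{\lambda_2\}}|a_{\{\lambda_3\}}$ survives to $E_2$, the element $a_{\{\lambda_1,\lambda_2,\lambda_3,\lambda_5\}}-a_{\{\lambda_1,\lambda_2,\lambda_3,\lambda_4\}}$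 survives to $E_2$ as well, and $$d_2\big[a_{\{\lambda_1\}}|a_{\{\lambda_2\}}|a_{\{\lambda_3\}}\big]=\big[a_{\{\lambda_1,\lambda_2,\lambda_3,\lambda_5\}}-a_{\{\lambda_1,\lambda_2,\lambda_3,\lambda_4\}}\big]\in E_2^0 .$$ -/

import Mathlib

universe u

/-- The sign `(-1)^e` attached to a parity `e`. -/
def sgn (e : ZMod 2) : ℚ := (-1) ^ e.val

lemma sgn_zero : sgn 0 = 1 := rfl
lemma sgn_one : sgn 1 = -1 := by simp [sgn, ZMod.val_one]
lemma sgn_add (a b : ZMod 2) : sgn (a + b) = sgn a * sgn b := by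
  revert a b; 
  have h : ∀ a b : ZMod 2, (a + b = 0 ∧ (a = 0 ∧ b = 0 ∨ a = 1 ∧ b = 1)) ∨
    (a + b = 1 ∧ (a = 0 ∧ b = 1 ∨ a = 1 ∧ b = 0)) := by decide
  intro a b
  rcases h a b with ⟨h1, ⟨h2, h3⟩ | ⟨h2, h3⟩⟩ | ⟨h1, ⟨h2, h3⟩ | ⟨h2, h3⟩⟩ <;>
    rw [h1, h2, h3] <;> simp [sgn_zero, sgn_one]
lemma sgn_mul_self (a : ZMod 2) : sgn a * sgn a = 1 := by
  rw [← sgn_add, CharTwo.add_self_eq_zero, sgn_zero]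

/-! ### Augmented commutative differential graded algebras over `ℚ` -/

/-- An augmented commutative differential `ℤ`-graded algebra over `ℚ` (cohomological grading). -/
structure AugCDGA where
  carrier : Type u
  [acg : AddCommGroup carrier]
  [mod : Module ℚ carrier]
  gr : ℤ → Submodule ℚ carrier
  internal : DirectSum.IsInternal gr
  one : carrier
  mul : carrier →ₗ[ℚ] carrier →ₗ[ℚ] carrier
  d : carrier →ₗ[ℚ] carrier
  aug : carrier →ₗ[ℚ] ℚ
  one_mem : one ∈ gr 0
  mul_mem : ∀ {i j : ℤ} {x y : carrier}, x ∈ gr i → y ∈ gr j → mul x y ∈ gr (i + j)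
  d_mem : ∀ {i : ℤ} {x : carrier}, x ∈ gr i → d x ∈ gr (i + 1)
  one_mul : ∀ x, mul one x = x
  mul_assoc : ∀ x y z, mul (mul x y) z = mul x (mul y z)
  mul_comm : ∀ {i j : ℤ} {x y : carrier}, x ∈ gr i → y ∈ gr j →
    mul x y = sgn ((i : ZMod 2) * (j : ZMod 2)) • mul y x
  d_mul : ∀ {i : ℤ} {x : carrier} (y : carrier), x ∈ gr i →
    d (mul x y) = mul (d x) y + sgn (i : ZMod 2) • mul x (d y)
  d_d : ∀ x, d (d x) = 0
  aug_one : aug one = 1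
  aug_mul : ∀ x y, aug (mul x y) = aug x * aug y
  aug_d : ∀ x, aug (d x) = 0
  aug_gr : ∀ {i : ℤ} {x : carrier}, x ∈ gr i → i ≠ 0 → aug x = 0

attribute [instance] AugCDGA.acg AugCDGA.mod

/-! ### Trees -/

/-- A finite directed graph with vertex set `S` and edges `E` (an edge `(i, j)` points from `i` to
`j`) is a tree: it is connected and has one edge less than it has vertices.  In particular it has
no loops, no multiple edges and no (undirected) cycles. -/
structure IsDirTree (S : Finset ℕ) (E : Multiset (ℕ × ℕ)) : Prop where
  mem : ∀ e ∈ E, e.1 ∈ S ∧ e.2 ∈ S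
  conn : ∀ u ∈ S, ∀ v ∈ S, Relation.EqvGen (fun x y => (x, y) ∈ E) u v
  card : E.card + 1 = S.card

/-- The map on vertices which identifies the vertex `j` with the vertex `i`. -/
def collapse (i j v : ℕ) : ℕ := if v = j then i else v

/-- The edges left after contracting the edge `e = (i, j)`; the new vertex is called `i`. -/
def contractEdges (E : Multiset (ℕ × ℕ)) (e : ℕ × ℕ) : Multiset (ℕ × ℕ) :=
  (E.erase e).map (Prod.map (collapse e.1 e.2) (collapse e.1 e.2))

lemma contractEdges_conn {E : Multiset (ℕ × ℕ)} {e : ℕ × ℕ} {u v : ℕ}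
    (h : Relation.EqvGen (fun x y => (x, y) ∈ E) u v) :
    Relation.EqvGen (fun x y => (x, y) ∈ contractEdges E e)
      (collapse e.1 e.2 u) (collapse e.1 e.2 v) := by
  induction h with
  | rel x y h =>
    by_cases he : (x, y) = e
    · subst he
      have : collapse x y x = collapse x y y := by simp [collapse]
      simp only [this]
      exact Relation.EqvGen.refl _
    · refine Relation.EqvGen.rel _ _ ?_
      exact Multiset.mem_map.2 ⟨(x, y), (Multiset.mem_erase_of_ne he).2 h, rfl⟩
  | refl x => exact Relation.EqvGen.refl _
  | symm x y _ ih => exact Relation.EqvGen.symm _ _ ih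
  | trans x y z _ _ ih1 ih2 => exact Relation.EqvGen.trans _ _ _ ih1 ih2

lemma card_contractEdges {E : Multiset (ℕ × ℕ)} {e : ℕ × ℕ} (he : e ∈ E) :
    (contractEdges E e).card + 1 = E.card := by
  rw [contractEdges, Multiset.card_map, Multiset.card_erase_add_one he]

lemma conn_card_le (n : ℕ) : ∀ (S : Finset ℕ) (E : Multiset (ℕ × ℕ)), E.card = n →
    (∀ u ∈ S, ∀ v ∈ S, Relation.EqvGen (fun x y => (x, y) ∈ E) u v) → S.card ≤ E.card + 1 := by
  induction n with
  | zero =>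
    intro S E hE h
    rw [Multiset.card_eq_zero] at hE
    subst hE
    simp only [Multiset.card_zero, zero_add]
    rw [Finset.card_le_one]
    intro a ha b hb
    have key : ∀ x y, Relation.EqvGen (fun x y : ℕ => (x, y) ∈ (0 : Multiset (ℕ × ℕ))) x y →
        x = y := by
      intro x y hxy
      induction hxy with
      | rel x y h => simp at h
      | refl x => rfl
      | symm x y _ ih => exact ih.symm
      | trans x y z _ _ h1 h2 => exact h1.trans h2
    exact key _ _ (h a ha b hb)
  | succ n ih =>
    intro S E hE h
    obtain ⟨e, he⟩ : ∃ e, e ∈ E := Multiset.card_pos_iff_exists_mem.1 (by omega)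
    have hc := card_contractEdges he
    have h1 := ih (S.image (collapse e.1 e.2)) (contractEdges E e) (by omega) (by
      intro u hu v hv
      obtain ⟨a, ha, rfl⟩ := Finset.mem_image.1 hu
      obtain ⟨b, hb, rfl⟩ := Finset.mem_image.1 hv
      exact contractEdges_conn (h a ha b hb))
    have h2 : S.erase e.2 ⊆ S.image (collapse e.1 e.2) := by
      intro v hv
      rw [Finset.mem_erase] at hv
      exact Finset.mem_image.2 ⟨v, hv.2, by simp [collapse, hv.1]⟩
    have h3 := Finset.card_le_card h2
    have h4 := Finset.pred_card_le_card_erase (s := S) (a := e.2)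
    omega

lemma IsDirTree.ne {S : Finset ℕ} {E : Multiset (ℕ × ℕ)} (h : IsDirTree S E) {e : ℕ × ℕ}
    (he : e ∈ E) : e.1 ≠ e.2 := by
  intro hl
  have hid : ∀ v, collapse e.1 e.2 v = v := by
    intro v; unfold collapse; split_ifs with hv
    · rw [hl, hv]
    · rfl
  have h1 := conn_card_le _ S (contractEdges E e) rfl (by
    intro u hu v hv
    have := contractEdges_conn (e := e) (h.conn u hu v hv)
    rwa [hid, hid] at this)
  have h2 := card_contractEdges he
  have h3 := h.card
  omega

lemma IsDirTree.contract {S : Finset ℕ} {E : Multiset (ℕ × ℕ)} (h : IsDirTree S E) {e : ℕ × ℕ}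
    (he : e ∈ E) : IsDirTree (S.erase e.2) (contractEdges E e) where
  mem := by
    intro e' he'
    obtain ⟨e0, h0, rfl⟩ := Multiset.mem_map.1 he'
    have h1 := h.mem _ (Multiset.mem_of_mem_erase h0)
    have h2 := h.mem _ he
    have h3 := h.ne he
    have key : ∀ v ∈ S, collapse e.1 e.2 v ∈ S.erase e.2 := by
      intro v hv
      unfold collapse
      split_ifs with hh
      · exact Finset.mem_erase.2 ⟨h3, h2.1⟩
      · exact Finset.mem_erase.2 ⟨hh, hv⟩
    exact ⟨key _ h1.1, key _ h1.2⟩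
  conn := by
    intro u hu v hv
    rw [Finset.mem_erase] at hu hv
    have := contractEdges_conn (e := e) (h.conn u hu.2 v hv.2)
    simpa [collapse, hu.1, hv.1] using this
  card := by
    have h2 := card_contractEdges he
    have h3 := h.card
    rw [Finset.card_erase_of_mem (h.mem _ he).2]
    omega

/-! ### Signs -/

/-- The total parity of the entries standing before position `v`. -/
def before (S : Finset ℕ) (ε : ℕ → ZMod 2) (v : ℕ) : ZMod 2 := ∑ u ∈ S with u < v, ε u

/-- The Koszul sign of permuting entries of parities `ε` according to `f`. -/
def koszul (f : ℕ → ℕ) (S : Finset ℕ) (ε : ℕ → ZMod 2) : ZMod 2 :=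
  ∑ x ∈ S, ∑ y ∈ S, if x < y ∧ f y < f x then ε x * ε y else 0

/-- The sign of contracting the edge `i → j`: the entries at `i` and `j` are moved to the first and
second place (Koszul signs), they are multiplied with the sign `(-1)^{|a|}`, where `a` is the entry
at `i` and `|a| = ε i + 1`, and the product is moved back to the position `i`. -/
def muSign (S : Finset ℕ) (ε : ℕ → ZMod 2) (i j : ℕ) : ZMod 2 :=
  ε i * before S ε i + ε j * before (S.erase i) ε j + (ε i + 1) +
    (ε i + ε j + 1) * before (S.erase j) ε i

/-- Auxiliary indicator. -/
def ltInd (x y : ℕ) : ZMod 2 := if x < y then 1 else 0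

lemma ltInd_self (x : ℕ) : ltInd x x = 0 := by simp [ltInd]
lemma ltInd_symm {x y : ℕ} (h : x ≠ y) : ltInd x y = 1 + ltInd y x := by
  unfold ltInd
  rcases lt_or_gt_of_ne h with h | h
  · simp [h, h.not_gt]
  · simp [h, h.not_gt]; decide

lemma before_eq (S : Finset ℕ) (ε : ℕ → ZMod 2) (v : ℕ) :
    before S ε v = ∑ u ∈ S, ltInd u v * ε u := by
  unfold before ltInd
  rw [Finset.sum_filter]
  exact Finset.sum_congr rfl fun u _ => by split_ifs <;> simp

lemma zmod2_two : (2 : ZMod 2) = 0 := rfl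

lemma muSign_insert {R : Finset ℕ} {ε : ℕ → ZMod 2} {i j : ℕ} (hij : i ≠ j)
    (hi : i ∉ R) (hj : j ∉ R) :
    muSign (insert i (insert j R)) ε i j = ε i + 1 + ltInd j i * ε i * ε j +
      ∑ k ∈ R, ε k * (ε j * (ltInd k j + ltInd k i) + ltInd k i) := by
  have h1 : (insert i (insert j R)).erase i = insert j R := by
    rw [Finset.erase_insert]; simp [hij, hi]
  have h2 : (insert i (insert j R)).erase j = insert i R := by
    rw [Finset.insert_comm, Finset.erase_insert]; simp [hij.symm, hj]
  unfold muSign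
  rw [h1, h2]
  simp only [before_eq]
  rw [Finset.sum_insert (by simp [hij, hi]), Finset.sum_insert hj, Finset.sum_insert hi,
    Finset.sum_insert hj]
  simp only [ltInd_self, mul_add, Finset.sum_add_distrib, Finset.mul_sum]
  have e1 : ∀ c d, ∑ k ∈ R, c * (ltInd k d * ε k) = c * ∑ k ∈ R, ltInd k d * ε k :=
    fun c d => (Finset.mul_sum _ _ _).symm
  have e2 : ∀ c d, ∑ k ∈ R, ε k * (c * ltInd k d) = c * ∑ k ∈ R, ltInd k d * ε k := by
    intro c d; rw [Finset.mul_sum]; exact Finset.sum_congr rfl fun _ _ => by ring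
  have e3 : ∀ d, ∑ k ∈ R, ε k * (ltInd k d) = ∑ k ∈ R, ltInd k d * ε k := by
    intro d; exact Finset.sum_congr rfl fun _ _ => by ring
  simp only [e1, e2, e3]
  generalize ∑ k ∈ R, ltInd k i * ε k = A
  generalize ∑ k ∈ R, ltInd k j * ε k = B
  linear_combination (ε i * A) * zmod2_two

lemma koszul_insert {f : ℕ → ℕ} {R : Finset ℕ} {ε : ℕ → ZMod 2} {i : ℕ} (hi : i ∉ R)
    (hf : Set.InjOn f (insert i R : Finset ℕ)) :
    koszul f (insert i R) ε = koszul f R ε +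
      ∑ k ∈ R, ε i * ε k * (ltInd k i + ltInd (f k) (f i)) := by
  unfold koszul
  rw [Finset.sum_insert hi, Finset.sum_insert hi]
  simp only [Finset.sum_insert hi, lt_irrefl, false_and, if_false, zero_add,
    Finset.sum_add_distrib]
  rw [← add_assoc, ← Finset.sum_add_distrib, add_comm]
  congr 1
  refine Finset.sum_congr rfl fun k hk => ?_
  have hki : k ≠ i := fun h => hi (h ▸ hk)
  have hfki : f k ≠ f i := fun h => hki (hf (by simp [hk]) (by simp) h)
  unfold ltInd
  rcases lt_or_gt_of_ne hki with h1 | h1 <;> rcases lt_or_gt_of_ne hfki with h2 | h2 <;>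
    simp [h1, h2, h1.not_gt, h2.not_gt, mul_comm]
  right; decide

lemma koszul_congr {f : ℕ → ℕ} {R : Finset ℕ} {ε ε' : ℕ → ZMod 2} (h : ∀ k ∈ R, ε k = ε' k) :
    koszul f R ε = koszul f R ε' := by
  unfold koszul
  refine Finset.sum_congr rfl fun k hk => Finset.sum_congr rfl fun l hl => ?_
  rw [h k hk, h l hl]

lemma koszul_fix {f : ℕ → ℕ} {R : Finset ℕ} {ε : ℕ → ZMod 2} (h : ∀ k ∈ R, f k = k) :
    koszul f R ε = 0 := by
  unfold koszul
  refine Finset.sum_eq_zero fun k hk => Finset.sum_eq_zero fun l hl => ?_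
  rw [h k hk, h l hl, if_neg]
  omega

lemma exists_split {S : Finset ℕ} {i j : ℕ} (hi : i ∈ S) (hj : j ∈ S) (hij : i ≠ j) :
    ∃ R : Finset ℕ, i ∉ R ∧ j ∉ R ∧ S = insert i (insert j R) := by
  refine ⟨(S.erase i).erase j, by simp, by simp, ?_⟩
  rw [Finset.insert_erase, Finset.insert_erase hi]
  simp [hj, hij.symm]

/-- Compatibility of the contraction sign with the Koszul sign. -/
lemma muSign_perm {f : ℕ → ℕ} {S : Finset ℕ} {ε ε' : ℕ → ZMod 2} {i j : ℕ} (hi : i ∈ S)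
    (hj : j ∈ S) (hij : i ≠ j) (hf : Set.InjOn f S) (hε : ∀ v ∈ S, ε' (f v) = ε v)
    {η : ℕ → ZMod 2} (hη : ∀ v ∈ S, v ≠ i → η v = ε v) (hηi : η i = ε i + ε j + 1) :
    koszul f S ε + muSign (S.image f) ε' (f i) (f j) =
      muSign S ε i j + koszul f (S.erase j) η := by
  obtain ⟨R, hiR, hjR, rfl⟩ := exists_split hi hj hij
  have h2 : (insert i (insert j R)).erase j = insert i R := by
    rw [Finset.insert_comm, Finset.erase_insert]; simp [hij.symm, hjR]
  have hfi : ∀ k ∈ R, f k ≠ f i := fun k hk h => hiR (by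
    have := hf (by simp [hk]) (by simp) h; rwa [← this])
  have hfj : ∀ k ∈ R, f k ≠ f j := fun k hk h => hjR (by
    have := hf (by simp [hk]) (by simp) h; rwa [← this])
  have hfij : f i ≠ f j := fun h => hij (hf (by simp) (by simp) h)
  rw [h2, Finset.image_insert, Finset.image_insert,
    muSign_insert hfij (by simpa using hfi) (by simpa using hfj), muSign_insert hij hiR hjR,
    koszul_insert (by simp [hij, hiR]) hf,
    koszul_insert hjR (hf.mono (by simp)),
    koszul_insert hiR (hf.mono (by
      intro x hx; simp at hx ⊢; tauto)),
    Finset.sum_insert hjR, Finset.sum_image (fun x hx y hy h => hf (by simp at hx; simp [hx])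
      (by simp at hy; simp [hy]) h),
    koszul_congr (ε := η) (ε' := ε) (fun k hk => hη k (by simp [hk]) (fun h => hiR (h ▸ hk))),
    hε i (by simp), hε j (by simp), hηi]
  have e1 : ∑ k ∈ R, ε' (f k) * (ε j * (ltInd (f k) (f j) + ltInd (f k) (f i)) +
      ltInd (f k) (f i)) = ∑ k ∈ R, ε k * (ε j * (ltInd (f k) (f j) + ltInd (f k) (f i)) +
      ltInd (f k) (f i)) :=
    Finset.sum_congr rfl fun k hk => by rw [hε k (by simp [hk])]
  have e2 : ∑ k ∈ R, (ε i + ε j + 1) * η k * (ltInd k i + ltInd (f k) (f i)) =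
      ∑ k ∈ R, (ε i + ε j + 1) * ε k * (ltInd k i + ltInd (f k) (f i)) :=
    Finset.sum_congr rfl fun k hk => by
      rw [hη k (by simp [hk]) (fun h => hiR (h ▸ hk))]
  rw [e1, e2]
  have e3 : ∑ k ∈ R, ε j * ε k * (ltInd k j + ltInd (f k) (f j)) +
      ∑ k ∈ R, ε i * ε k * (ltInd k i + ltInd (f k) (f i)) +
      ∑ k ∈ R, ε k * (ε j * (ltInd (f k) (f j) + ltInd (f k) (f i)) + ltInd (f k) (f i)) =
      ∑ k ∈ R, ε k * (ε j * (ltInd k j + ltInd k i) + ltInd k i) +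
      ∑ k ∈ R, (ε i + ε j + 1) * ε k * (ltInd k i + ltInd (f k) (f i)) := by
    simp only [← Finset.sum_add_distrib]
    refine Finset.sum_congr rfl fun k hk => ?_
    linear_combination (ε k * ε j * ltInd (f k) (f j) - ε k * ε j * ltInd k i
      - ε k * ltInd k i) * zmod2_two
  linear_combination e3 + (ε i * ε j * ltInd (f j) (f i)) * zmod2_two


/-! ### The graph complex -/

namespace AugCDGA

variable (W : AugCDGA.{u})

/-- A homogeneous element of the augmentation ideal of `W`, together with its degree. -/
@[ext] structure Hom where
  deg : ℤ
  val : W.carrier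
  mem : val ∈ W.gr deg
  aug_val : W.aug val = 0

variable {W}

/-- The parity of the desuspension `s⁻¹ a`, an element of degree `|a| - 1`. -/
def Hom.par (a : W.Hom) : ZMod 2 := ((a.deg - 1 : ℤ) : ZMod 2)

/-- The product of two homogeneous elements. -/
def Hom.mul (a b : W.Hom) : W.Hom where
  deg := a.deg + b.deg
  val := W.mul a.val b.val
  mem := W.mul_mem a.mem b.mem
  aug_val := by rw [W.aug_mul, a.aug_val, zero_mul]

/-- The differential of a homogeneous element. -/
def Hom.d (a : W.Hom) : W.Hom where
  deg := a.deg + 1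
  val := W.d a.val
  mem := W.d_mem a.mem
  aug_val := W.aug_d _

lemma Hom.par_mul (a b : W.Hom) : (a.mul b).par = a.par + b.par + 1 := by
  simp only [Hom.par, Hom.mul]; push_cast; ring
lemma Hom.par_d (a : W.Hom) : a.d.par = a.par + 1 := by
  simp only [Hom.par, Hom.d]; push_cast; ring
lemma Hom.deg_cast (a : W.Hom) : ((a.deg : ℤ) : ZMod 2) = a.par + 1 := by
  simp only [Hom.par]; push_cast; ring

variable (W)

/-- A tree whose vertices are labelled by homogeneous elements of the augmentation ideal.  The
vertices are natural numbers; their order is the order of the factors in the tensor product of the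
(desuspended) labels.  The values of `lab` outside `verts` are irrelevant. -/
structure Gen where
  verts : Finset ℕ
  edges : Multiset (ℕ × ℕ)
  lab : ℕ → W.Hom
  tree : IsDirTree verts edges

variable {W}

/-- Parities of the (desuspended) labels. -/
def Gen.ε (g : W.Gen) (v : ℕ) : ZMod 2 := (g.lab v).par

/-- `g` and `g'` differ by the renumbering `f` of the vertices. -/
structure IsRelabel (f : ℕ → ℕ) (g g' : W.Gen) : Prop where
  inj : Set.InjOn f g.verts
  verts : g'.verts = g.verts.image f
  edges : g'.edges = g.edges.map (Prod.map f f)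
  lab : ∀ v ∈ g.verts, g'.lab (f v) = g.lab v

/-- `g` and `g'` differ by the direction of one edge. -/
structure IsReverse (i j : ℕ) (T : Multiset (ℕ × ℕ)) (g g' : W.Gen) : Prop where
  verts : g'.verts = g.verts
  lab : g'.lab = g.lab
  edges : g.edges = (i, j) ::ₘ T
  edges' : g'.edges = (j, i) ::ₘ T

/-- `g₁, g₂, g₃` are the three graphs in an Arnold identity. -/
structure IsArnold (a b c : ℕ) (T : Multiset (ℕ × ℕ)) (g₁ g₂ g₃ : W.Gen) : Prop where
  verts₂ : g₂.verts = g₁.verts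
  verts₃ : g₃.verts = g₁.verts
  lab₂ : g₂.lab = g₁.lab
  lab₃ : g₃.lab = g₁.lab
  edges₁ : g₁.edges = (a, b) ::ₘ (b, c) ::ₘ T
  edges₂ : g₂.edges = (b, c) ::ₘ (c, a) ::ₘ T
  edges₃ : g₃.edges = (c, a) ::ₘ (a, b) ::ₘ T

/-- `g''` has at the vertex `x` the label `r • (label of g) + s • (label of g')`; otherwise the
three agree. -/
structure IsLin (x : ℕ) (r s : ℚ) (g g' g'' : W.Gen) : Prop where
  mem : x ∈ g.verts
  verts : g'.verts = g.verts
  verts' : g''.verts = g.verts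
  edges : g'.edges = g.edges
  edges' : g''.edges = g.edges
  lab : ∀ v ∈ g.verts, v ≠ x → g'.lab v = g.lab v
  lab' : ∀ v ∈ g.verts, v ≠ x → g''.lab v = g.lab v
  deg : (g'.lab x).deg = (g.lab x).deg
  deg' : (g''.lab x).deg = (g.lab x).deg
  val : (g''.lab x).val = r • (g.lab x).val + s • (g'.lab x).val

variable (W)

/-- The relations in the graph complex: multilinearity in the labels, symmetric group
coinvariants (with Koszul signs), reversing arrows, and the Arnold identity. -/
inductive Rel : (W.Gen →₀ ℚ) → Prop
  | lin {x : ℕ} {r s : ℚ} {g g' g'' : W.Gen} (h : IsLin x r s g g' g'') :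
      Rel (Finsupp.single g'' 1 - (r • Finsupp.single g 1 + s • Finsupp.single g' 1))
  | perm {f : ℕ → ℕ} {g g' : W.Gen} (h : IsRelabel f g g') :
      Rel (Finsupp.single g 1 - sgn (koszul f g.verts g.ε) • Finsupp.single g' 1)
  | rev {i j : ℕ} {T : Multiset (ℕ × ℕ)} {g g' : W.Gen} (h : IsReverse i j T g g') :
      Rel (Finsupp.single g 1 + Finsupp.single g' 1)
  | arnold {a b c : ℕ} {T : Multiset (ℕ × ℕ)} {g₁ g₂ g₃ : W.Gen}
      (h : IsArnold a b c T g₁ g₂ g₃) :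
      Rel (Finsupp.single g₁ 1 + Finsupp.single g₂ 1 + Finsupp.single g₃ 1)

/-- The underlying vector space of the Sinha-Walter complex of `W`: the cofree Lie coalgebra
`𝔼(s⁻¹ W̄) = ⨁ₙ (Graphs(n)/∼) ⊗_{Σₙ} (s⁻¹ W̄)^{⊗ n}`, `W̄` the augmentation ideal. -/
abbrev EE : Type u := (W.Gen →₀ ℚ) ⧸ Submodule.span ℚ {x | W.Rel x}

variable {W}

/-- The class of a labelled tree. -/
noncomputable def Gen.cls (g : W.Gen) : W.EE := Submodule.Quotient.mk (Finsupp.single g 1)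

lemma mk_eq_zero_of_rel {x : W.Gen →₀ ℚ} (h : W.Rel x) :
    (Submodule.Quotient.mk x : W.EE) = 0 :=
  (Submodule.Quotient.mk_eq_zero _).2 (Submodule.subset_span h)

lemma cls_lin {x : ℕ} {r s : ℚ} {g g' g'' : W.Gen} (h : IsLin x r s g g' g'') :
    g''.cls = r • g.cls + s • g'.cls :=
  sub_eq_zero.1 (mk_eq_zero_of_rel (Rel.lin h))

lemma cls_perm {f : ℕ → ℕ} {g g' : W.Gen} (h : IsRelabel f g g') :
    g.cls = sgn (koszul f g.verts g.ε) • g'.cls :=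
  sub_eq_zero.1 (mk_eq_zero_of_rel (Rel.perm h))

lemma cls_rev {i j : ℕ} {T : Multiset (ℕ × ℕ)} {g g' : W.Gen} (h : IsReverse i j T g g') :
    g.cls + g'.cls = 0 :=
  mk_eq_zero_of_rel (Rel.rev h)

lemma cls_arnold {a b c : ℕ} {T : Multiset (ℕ × ℕ)} {g₁ g₂ g₃ : W.Gen}
    (h : IsArnold a b c T g₁ g₂ g₃) : g₁.cls + g₂.cls + g₃.cls = 0 :=
  mk_eq_zero_of_rel (Rel.arnold h)

lemma cls_congr {g g' : W.Gen} (h1 : g'.verts = g.verts) (h2 : g'.edges = g.edges)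
    (h3 : ∀ v ∈ g.verts, g'.lab v = g.lab v) : g.cls = g'.cls := by
  have h : IsRelabel id g g' :=
    ⟨Set.injOn_id _, by simpa using h1, by simpa using h2, h3⟩
  have := cls_perm h
  rwa [koszul_fix (f := id) (fun _ _ => rfl), sgn_zero, one_smul] at this

/-- A relation on elements of `𝔼` which only differ by a scalar at one label. -/
lemma cls_smul {g g'' : W.Gen} (x : ℕ) (r : ℚ) (hx : x ∈ g.verts) (h1 : g''.verts = g.verts)
    (h2 : g''.edges = g.edges) (h3 : ∀ v ∈ g.verts, v ≠ x → g''.lab v = g.lab v)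
    (h4 : (g''.lab x).deg = (g.lab x).deg) (h5 : (g''.lab x).val = r • (g.lab x).val) :
    g''.cls = r • g.cls := by
  have h : IsLin x r 0 g g g'' :=
    ⟨hx, rfl, h1, rfl, h2, fun _ _ _ => rfl, h3, rfl, h4, by simp [h5]⟩
  simpa using cls_lin h

lemma cls_zero {g : W.Gen} (x : ℕ) (hx : x ∈ g.verts) (h : (g.lab x).val = 0) : g.cls = 0 := by
  simpa using cls_smul (g := g) (g'' := g) x 0 hx rfl rfl (fun _ _ _ => rfl) rfl (by simp [h])

/-! ### The differentials -/

/-- Contraction of an edge. -/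
def Gen.contract (g : W.Gen) (e : ℕ × ℕ) (he : e ∈ g.edges) : W.Gen where
  verts := g.verts.erase e.2
  edges := contractEdges g.edges e
  lab := Function.update g.lab e.1 ((g.lab e.1).mul (g.lab e.2))
  tree := g.tree.contract he

open Classical in
/-- The signed contraction `μ_e`. -/
noncomputable def muE (g : W.Gen) (e : ℕ × ℕ) : W.EE :=
  if he : e ∈ g.edges then sgn (muSign g.verts g.ε e.1 e.2) • (g.contract e he).cls else 0

/-- `d_μ` on a labelled tree. -/
noncomputable def dMuGen (g : W.Gen) : W.EE := (g.edges.map (muE g)).sum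

/-- The labelled tree obtained by differentiating the label at `x`. -/
def Gen.diff (g : W.Gen) (x : ℕ) : W.Gen where
  verts := g.verts
  edges := g.edges
  lab := Function.update g.lab x (g.lab x).d
  tree := g.tree

/-- `d_W` on a labelled tree: the Leibniz extension of the differential of `W`. -/
noncomputable def dWGen (g : W.Gen) : W.EE :=
  ∑ x ∈ g.verts, sgn (before g.verts g.ε x) • (g.diff x).cls

lemma muE_of_mem {g : W.Gen} {e : ℕ × ℕ} (he : e ∈ g.edges) :
    muE g e = sgn (muSign g.verts g.ε e.1 e.2) • (g.contract e he).cls := dif_pos he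

lemma before_congr {S : Finset ℕ} {ε ε' : ℕ → ZMod 2} (h : ∀ v ∈ S, ε' v = ε v) (v : ℕ) :
    before S ε' v = before S ε v :=
  Finset.sum_congr rfl fun u hu => h u (Finset.mem_of_mem_filter u hu)

lemma muSign_congr {S : Finset ℕ} {ε ε' : ℕ → ZMod 2} (h : ∀ v ∈ S, ε' v = ε v) {i j : ℕ}
    (hi : i ∈ S) (hj : j ∈ S) : muSign S ε' i j = muSign S ε i j := by
  unfold muSign
  rw [before_congr h, before_congr (S := S.erase i) (fun v hv => h v (Finset.mem_of_mem_erase hv)),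
    before_congr (S := S.erase j) (fun v hv => h v (Finset.mem_of_mem_erase hv)), h i hi, h j hj]

lemma contract_ε (g : W.Gen) {e : ℕ × ℕ} (he : e ∈ g.edges) :
    (g.contract e he).ε = Function.update g.ε e.1 (g.ε e.1 + g.ε e.2 + 1) := by
  funext v
  unfold Gen.ε Gen.contract
  by_cases h : v = e.1
  · subst h; simp [Hom.par_mul]
  · simp [h]

lemma diff_ε (g : W.Gen) (x : ℕ) : (g.diff x).ε = Function.update g.ε x (g.ε x + 1) := by
  funext v
  unfold Gen.ε Gen.diff
  by_cases h : v = x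
  · subst h; simp [Hom.par_d]
  · simp [h]

/-! #### Compatibility with renumbering -/

lemma muE_perm {f : ℕ → ℕ} {g g' : W.Gen} (h : IsRelabel f g g') {e : ℕ × ℕ} (he : e ∈ g.edges) :
    muE g e = sgn (koszul f g.verts g.ε) • muE g' (Prod.map f f e) := by
  have he' : Prod.map f f e ∈ g'.edges := by
    rw [h.edges]; exact Multiset.mem_map_of_mem _ he
  obtain ⟨hi, hj⟩ := g.tree.mem e he
  have hij := g.tree.ne he
  have hc : IsRelabel f (g.contract e he) (g'.contract _ he') := by
    refine ⟨h.inj.mono (by simp [Gen.contract]), ?_, ?_, ?_⟩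
    · simp only [Gen.contract, h.verts]
      ext v
      simp only [Finset.mem_erase, Finset.mem_image, Prod.map_snd]
      constructor
      · rintro ⟨h1, u, hu, rfl⟩
        exact ⟨u, ⟨fun h => h1 (h ▸ rfl), hu⟩, rfl⟩
      · rintro ⟨u, ⟨h1, hu⟩, rfl⟩
        exact ⟨fun h2 => h1 (h.inj hu hj h2), u, hu, rfl⟩
    · simp only [Gen.contract, contractEdges, h.edges]
      rw [← Multiset.map_erase_of_mem _ _ he, Multiset.map_map, Multiset.map_map]
      refine Multiset.map_congr rfl fun e0 h0 => ?_
      have h0' := g.tree.mem e0 (Multiset.mem_of_mem_erase h0)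
      have key : ∀ v ∈ g.verts, collapse (f e.1) (f e.2) (f v) = f (collapse e.1 e.2 v) := by
        intro v hv
        unfold collapse
        by_cases hve : v = e.2
        · simp [hve]
        · rw [if_neg hve, if_neg (fun h2 => hve (h.inj hv hj h2))]
      simp [Prod.map, key _ h0'.1, key _ h0'.2]
    · intro v hv
      have hv' : v ∈ g.verts := Finset.mem_of_mem_erase hv
      simp only [Gen.contract, Prod.map_fst, Prod.map_snd]
      by_cases hve : v = e.1
      · subst hve; simp [h.lab _ hi, h.lab _ hj]
      · rw [Function.update_of_ne hve, Function.update_of_ne (fun h2 => hve (h.inj hv' hi h2)),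
          h.lab v hv']
  rw [muE_of_mem he, muE_of_mem he', cls_perm hc, smul_smul, smul_smul, ← sgn_add, ← sgn_add]
  congr 2
  have := muSign_perm (f := f) (S := g.verts) (ε := g.ε) (ε' := g'.ε) hi hj hij h.inj
    (fun v hv => by simp [Gen.ε, h.lab v hv]) (η := (g.contract e he).ε)
    (fun v _ hv => by rw [contract_ε, Function.update_of_ne hv])
    (by rw [contract_ε, Function.update_self])
  rw [h.verts]
  exact this.symm

lemma dMuGen_perm {f : ℕ → ℕ} {g g' : W.Gen} (h : IsRelabel f g g') :
    dMuGen g = sgn (koszul f g.verts g.ε) • dMuGen g' := by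
  unfold dMuGen
  rw [Multiset.smul_sum, h.edges, Multiset.map_map, Multiset.map_map]
  exact congrArg _ (Multiset.map_congr rfl fun e he => muE_perm h he)

/-- Compatibility of the signs of `d_W` with the Koszul sign. -/
lemma before_perm {f : ℕ → ℕ} {S : Finset ℕ} {ε ε' : ℕ → ZMod 2} {x : ℕ} (hx : x ∈ S)
    (hf : Set.InjOn f S) (hε : ∀ v ∈ S, ε' (f v) = ε v)
    {η : ℕ → ZMod 2} (hη : ∀ v ∈ S, v ≠ x → η v = ε v) (hηx : η x = ε x + 1) :
    koszul f S ε + before (S.image f) ε' (f x) = before S ε x + koszul f S η := by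
  obtain ⟨R, hxR, rfl⟩ : ∃ R : Finset ℕ, x ∉ R ∧ S = insert x R :=
    ⟨S.erase x, by simp, by rw [Finset.insert_erase hx]⟩
  rw [koszul_insert hxR hf, koszul_insert hxR hf, before_eq, before_eq,
    Finset.sum_image hf, Finset.sum_insert hxR,
    Finset.sum_insert hxR, ltInd_self, ltInd_self, hηx,
    koszul_congr (ε := η) (ε' := ε) (fun k hk => hη k (by simp [hk]) (fun h => hxR (h ▸ hk)))]
  have e1 : ∑ k ∈ R, ltInd (f k) (f x) * ε' (f k) = ∑ k ∈ R, ltInd (f k) (f x) * ε k :=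
    Finset.sum_congr rfl fun k hk => by rw [hε k (by simp [hk])]
  have e2 : ∑ k ∈ R, (ε x + 1) * η k * (ltInd k x + ltInd (f k) (f x)) =
      ∑ k ∈ R, (ε x + 1) * ε k * (ltInd k x + ltInd (f k) (f x)) :=
    Finset.sum_congr rfl fun k hk => by rw [hη k (by simp [hk]) (fun h => hxR (h ▸ hk))]
  rw [e1, e2]
  have e3 : ∑ k ∈ R, ε x * ε k * (ltInd k x + ltInd (f k) (f x)) +
      ∑ k ∈ R, ltInd (f k) (f x) * ε k = ∑ k ∈ R, ltInd k x * ε k +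
      ∑ k ∈ R, (ε x + 1) * ε k * (ltInd k x + ltInd (f k) (f x)) := by
    simp only [← Finset.sum_add_distrib]
    refine Finset.sum_congr rfl fun k hk => ?_
    linear_combination (- ε k * ltInd k x) * zmod2_two
  linear_combination e3

lemma dWGen_perm {f : ℕ → ℕ} {g g' : W.Gen} (h : IsRelabel f g g') :
    dWGen g = sgn (koszul f g.verts g.ε) • dWGen g' := by
  unfold dWGen
  rw [h.verts, Finset.sum_image h.inj, Finset.smul_sum]
  refine Finset.sum_congr rfl fun x hx => ?_
  have hc : IsRelabel f (g.diff x) (g'.diff (f x)) := by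
    refine ⟨h.inj, h.verts, h.edges, fun v hv => ?_⟩
    simp only [Gen.diff]
    by_cases hvx : v = x
    · subst hvx; simp [h.lab v hv]
    · rw [Function.update_of_ne hvx, Function.update_of_ne (fun h2 => hvx (h.inj hv hx h2)),
          h.lab v hv]
  rw [cls_perm hc, smul_smul, smul_smul, ← sgn_add, ← sgn_add]
  congr 2
  have := before_perm (f := f) (S := g.verts) (ε := g.ε) (ε' := g'.ε) hx h.inj
    (fun v hv => by simp [Gen.ε, h.lab v hv]) (η := (g.diff x).ε)
    (fun v _ hv => by rw [diff_ε, Function.update_of_ne hv])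
    (by rw [diff_ε, Function.update_self])
  exact this.symm

/-! #### Compatibility with reversing arrows and the Arnold identity -/

lemma contractEdges_cons {e e' : ℕ × ℕ} {T : Multiset (ℕ × ℕ)} (he' : e' ∈ T) :
    contractEdges (e ::ₘ T) e' =
      Prod.map (collapse e'.1 e'.2) (collapse e'.1 e'.2) e ::ₘ contractEdges T e' := by
  unfold contractEdges
  rw [Multiset.erase_cons_tail_of_mem he', Multiset.map_cons]

lemma contractEdges_cons_self {e : ℕ × ℕ} {T : Multiset (ℕ × ℕ)} :
    contractEdges (e ::ₘ T) e = T.map (Prod.map (collapse e.1 e.2) (collapse e.1 e.2)) := by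
  unfold contractEdges
  rw [Multiset.erase_cons_head]

lemma muSign_symm {S : Finset ℕ} {ε : ℕ → ZMod 2} {i j : ℕ} (hi : i ∈ S) (hj : j ∈ S)
    (hij : i ≠ j) {η : ℕ → ZMod 2} (hη : ∀ v ∈ S, v ≠ i → η v = ε v)
    (hηi : η i = ε i + ε j + 1) :
    muSign S ε i j + koszul (Equiv.swap i j) (S.erase j) η + (ε i + 1) * (ε j + 1) =
      muSign S ε j i + 1 := by
  obtain ⟨R, hiR, hjR, rfl⟩ := exists_split hi hj hij
  have h2 : (insert i (insert j R)).erase j = insert i R := by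
    rw [Finset.insert_comm, Finset.erase_insert]; simp [hij.symm, hjR]
  have hne : ∀ k ∈ R, k ≠ i ∧ k ≠ j := fun k hk => ⟨fun h => hiR (h ▸ hk), fun h => hjR (h ▸ hk)⟩
  have hsw : ∀ k ∈ R, Equiv.swap i j k = k := fun k hk =>
    Equiv.swap_apply_of_ne_of_ne (hne k hk).1 (hne k hk).2
  rw [h2, koszul_insert hiR (Equiv.injective _).injOn, koszul_fix hsw, muSign_insert hij hiR hjR,
    Finset.insert_comm, muSign_insert hij.symm hjR hiR, hηi, Equiv.swap_apply_left,
    ltInd_symm hij.symm]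
  have e2 : ∑ k ∈ R, (ε i + ε j + 1) * η k * (ltInd k i + ltInd (Equiv.swap i j k) j) =
      ∑ k ∈ R, (ε i + ε j + 1) * ε k * (ltInd k i + ltInd k j) :=
    Finset.sum_congr rfl fun k hk => by rw [hη k (by simp [hk]) (hne k hk).1, hsw k hk]
  rw [e2]
  have e3 : ∑ k ∈ R, ε k * (ε j * (ltInd k j + ltInd k i) + ltInd k i) +
      ∑ k ∈ R, (ε i + ε j + 1) * ε k * (ltInd k i + ltInd k j) =
      ∑ k ∈ R, ε k * (ε i * (ltInd k i + ltInd k j) + ltInd k j) := by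
    simp only [← Finset.sum_add_distrib]
    refine Finset.sum_congr rfl fun k hk => ?_
    linear_combination (ε k * ε j * (ltInd k j + ltInd k i) + ε k * ltInd k i) * zmod2_two
  linear_combination e3 + (ε i + ε i * ε j) * zmod2_two

lemma muE_rev_self {i j : ℕ} {T : Multiset (ℕ × ℕ)} {g g' : W.Gen} (h : IsReverse i j T g g') :
    muE g (i, j) + muE g' (j, i) = 0 := by
  have he : (i, j) ∈ g.edges := by rw [h.edges]; simp
  have he' : (j, i) ∈ g'.edges := by rw [h.edges']; simp
  obtain ⟨hi, hj⟩ := g.tree.mem _ he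
  have hij : i ≠ j := g.tree.ne he
  simp only at hi hj
  -- the contraction with the factors of the product interchanged
  let g1 : W.Gen := ⟨(g.contract _ he).verts, (g.contract _ he).edges,
    Function.update g.lab i ((g.lab j).mul (g.lab i)), (g.contract _ he).tree⟩
  have h1 : (g.contract _ he).cls = sgn ((g.ε i + 1) * (g.ε j + 1)) • g1.cls := by
    refine cls_smul i _ (by simp [g1, Gen.contract, hij, hi]) rfl rfl ?_ ?_ ?_
    · intro v _ hv
      simp [g1, Gen.contract, hv]
    · simp [g1, Gen.contract, Hom.mul, add_comm]
    · simp only [g1, Gen.contract, Hom.mul, Function.update_self]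
      rw [W.mul_comm (g.lab i).mem (g.lab j).mem, Hom.deg_cast, Hom.deg_cast]
      rfl
  have h2 : IsRelabel (Equiv.swap i j) g1 (g'.contract _ he') := by
    refine ⟨(Equiv.injective _).injOn, ?_, ?_, ?_⟩
    · simp only [g1, Gen.contract, h.verts]
      ext v
      simp only [Finset.mem_erase, Finset.mem_image]
      constructor
      · rintro ⟨h3, h4⟩
        by_cases hvj : v = j
        · exact ⟨i, ⟨hij, hi⟩, by simp [hvj]⟩
        · exact ⟨v, ⟨hvj, h4⟩, Equiv.swap_apply_of_ne_of_ne h3 hvj⟩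
      · rintro ⟨u, ⟨h3, h4⟩, rfl⟩
        by_cases hui : u = i
        · simp [hui, hij.symm, hj]
        · rw [Equiv.swap_apply_of_ne_of_ne hui h3]; exact ⟨hui, h4⟩
    · simp only [g1, Gen.contract, h.edges, h.edges', contractEdges_cons_self]
      rw [Multiset.map_map]
      refine Multiset.map_congr rfl fun e0 _ => ?_
      have key : ∀ v, Equiv.swap i j (collapse i j v) = collapse j i v := by
        intro v
        unfold collapse
        by_cases hvj : v = j
        · by_cases hvi : v = i
          · exact absurd (hvi.symm.trans hvj) hij
          · simp [hvj, hij.symm]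
        · by_cases hvi : v = i
          · simp [hvi, hij]
          · simp [hvi, hvj, Equiv.swap_apply_of_ne_of_ne]
      simp [Prod.map, key]
    · intro v hv
      simp only [g1, Gen.contract, Finset.mem_erase] at hv
      simp only [g1, Gen.contract, h.lab]
      by_cases hvi : v = i
      · simp [hvi]
      · rw [Equiv.swap_apply_of_ne_of_ne hvi hv.1]; simp [hvi, hv.1]
  rw [muE_of_mem he, muE_of_mem he', h1, cls_perm h2, smul_smul, smul_smul, ← sgn_add, ← sgn_add,
    ← add_smul]
  have h3 : g'.ε = g.ε := by funext v; simp [Gen.ε, h.lab]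
  have h4 : g1.ε = (g.contract _ he).ε := by
    rw [contract_ε]
    funext v
    by_cases hv : v = i
    · subst hv; simp [Gen.ε, g1, Hom.par_mul]; ring
    · simp [Gen.ε, g1, hv]
  have := muSign_symm hi hj hij (ε := g.ε) (η := g1.ε)
    (fun v _ hv => by rw [h4, contract_ε, Function.update_of_ne hv])
    (by rw [h4, contract_ε, Function.update_self])
  have h5 : muSign g.verts g.ε i j + ((g.ε i + 1) * (g.ε j + 1) +
      koszul (Equiv.swap i j) g1.verts g1.ε) = muSign g.verts g.ε j i + 1 := by
    rw [← this]; simp only [g1, Gen.contract]; ring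
  rw [h3, h.verts]
  simp only
  rw [add_assoc, h5, sgn_add, sgn_one]
  simp

lemma muE_rev_of_mem {i j : ℕ} {T : Multiset (ℕ × ℕ)} {g g' : W.Gen} (h : IsReverse i j T g g')
    {e : ℕ × ℕ} (he : e ∈ T) : muE g e + muE g' e = 0 := by
  have he1 : e ∈ g.edges := by rw [h.edges]; exact Multiset.mem_cons_of_mem he
  have he2 : e ∈ g'.edges := by rw [h.edges']; exact Multiset.mem_cons_of_mem he
  have h3 : g'.ε = g.ε := by funext v; simp [Gen.ε, h.lab]
  rw [muE_of_mem he1, muE_of_mem he2, h3, h.verts, ← smul_add,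
    cls_rev (i := collapse e.1 e.2 i) (j := collapse e.1 e.2 j) (T := contractEdges T e), smul_zero]
  exact ⟨by simp [Gen.contract, h.verts], by simp [Gen.contract, h.lab],
    by simp [Gen.contract, h.edges, contractEdges_cons he],
    by simp [Gen.contract, h.edges', contractEdges_cons he]⟩

lemma dMuGen_rev {i j : ℕ} {T : Multiset (ℕ × ℕ)} {g g' : W.Gen} (h : IsReverse i j T g g') :
    dMuGen g + dMuGen g' = 0 := by
  unfold dMuGen
  rw [h.edges, h.edges', Multiset.map_cons, Multiset.map_cons, Multiset.sum_cons,
    Multiset.sum_cons, add_add_add_comm, muE_rev_self h, zero_add, ← Multiset.sum_map_add]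
  refine Multiset.sum_eq_zero fun x hx => ?_
  obtain ⟨e, he, rfl⟩ := Multiset.mem_map.1 hx
  exact muE_rev_of_mem h he

lemma dWGen_rev {i j : ℕ} {T : Multiset (ℕ × ℕ)} {g g' : W.Gen} (h : IsReverse i j T g g') :
    dWGen g + dWGen g' = 0 := by
  unfold dWGen
  have h3 : g'.ε = g.ε := by funext v; simp [Gen.ε, h.lab]
  rw [h.verts, h3, ← Finset.sum_add_distrib]
  refine Finset.sum_eq_zero fun x _ => ?_
  rw [← smul_add, cls_rev (i := i) (j := j) (T := T), smul_zero]
  exact ⟨h.verts, by simp [Gen.diff, h.lab], h.edges, h.edges'⟩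

lemma collapse_left (i j : ℕ) : collapse i j i = i := by unfold collapse; split_ifs <;> rfl
lemma collapse_right (i j : ℕ) : collapse i j j = i := by simp [collapse]
lemma collapse_ne {i j v : ℕ} (h : v ≠ j) : collapse i j v = v := by simp [collapse, h]

/-- Contracting the common edge of two graphs which differ in the position of another edge at the
contracted one. -/
lemma muE_arnold_aux {g g' : W.Gen} {p q r : ℕ} {T : Multiset (ℕ × ℕ)}
    (hv : g'.verts = g.verts) (hl : g'.lab = g.lab)
    (he : g.edges = (p, q) ::ₘ (q, r) ::ₘ T) (he' : g'.edges = (r, p) ::ₘ (p, q) ::ₘ T)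
    (hrq : r ≠ q) :
    muE g (p, q) + muE g' (p, q) = 0 := by
  have he1 : (p, q) ∈ g.edges := by rw [he]; simp
  have he2 : (p, q) ∈ g'.edges := by rw [he']; simp
  have h3 : g'.ε = g.ε := by funext v; simp [Gen.ε, hl]
  rw [muE_of_mem he1, muE_of_mem he2, h3, hv, ← smul_add,
    cls_rev (i := p) (j := r) (T := T.map (Prod.map (collapse p q) (collapse p q))), smul_zero]
  refine ⟨by simp [Gen.contract, hv], by simp [Gen.contract, hl], ?_, ?_⟩
  · simp only [Gen.contract, he, contractEdges_cons_self, Multiset.map_cons, Prod.map,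
      collapse_right, collapse_ne hrq]
  · simp only [Gen.contract, he', Multiset.cons_swap (r, p), contractEdges_cons_self,
      Multiset.map_cons, Prod.map, collapse_left, collapse_ne hrq]

lemma dMuGen_arnold {a b c : ℕ} {T : Multiset (ℕ × ℕ)} {g₁ g₂ g₃ : W.Gen}
    (h : IsArnold a b c T g₁ g₂ g₃) : dMuGen g₁ + dMuGen g₂ + dMuGen g₃ = 0 := by
  have hab : a ≠ b := g₁.tree.ne (e := (a, b)) (by rw [h.edges₁]; simp)
  have hbc : b ≠ c := g₁.tree.ne (e := (b, c)) (by rw [h.edges₁]; simp)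
  have hca : c ≠ a := g₂.tree.ne (e := (c, a)) (by rw [h.edges₂]; simp)
  have k1 : muE g₁ (a, b) + muE g₃ (a, b) = 0 :=
    muE_arnold_aux h.verts₃ h.lab₃ h.edges₁ h.edges₃ hbc.symm
  have k2 : muE g₂ (b, c) + muE g₁ (b, c) = 0 :=
    muE_arnold_aux h.verts₂.symm h.lab₂.symm h.edges₂ h.edges₁ hca.symm
  have k3 : muE g₃ (c, a) + muE g₂ (c, a) = 0 :=
    muE_arnold_aux (h.verts₂.trans h.verts₃.symm) (h.lab₂.trans h.lab₃.symm) h.edges₃ h.edges₂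
      hab.symm
  have k4 : (T.map (muE g₁)).sum + (T.map (muE g₂)).sum + (T.map (muE g₃)).sum = 0 := by
    rw [← Multiset.sum_map_add, ← Multiset.sum_map_add]
    refine Multiset.sum_eq_zero fun x hx => ?_
    obtain ⟨e, he, rfl⟩ := Multiset.mem_map.1 hx
    have m1 : e ∈ g₁.edges := by rw [h.edges₁]; simp [he]
    have m2 : e ∈ g₂.edges := by rw [h.edges₂]; simp [he]
    have m3 : e ∈ g₃.edges := by rw [h.edges₃]; simp [he]
    have e2 : g₂.ε = g₁.ε := by funext v; simp [Gen.ε, h.lab₂]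
    have e3 : g₃.ε = g₁.ε := by funext v; simp [Gen.ε, h.lab₃]
    rw [muE_of_mem m1, muE_of_mem m2, muE_of_mem m3, e2, e3, h.verts₂, h.verts₃, ← smul_add,
      ← smul_add, cls_arnold (a := collapse e.1 e.2 a) (b := collapse e.1 e.2 b)
        (c := collapse e.1 e.2 c) (T := contractEdges T e), smul_zero]
    exact ⟨by simp [Gen.contract, h.verts₂], by simp [Gen.contract, h.verts₃],
      by simp [Gen.contract, h.lab₂], by simp [Gen.contract, h.lab₃],
      by simp [Gen.contract, h.edges₁, contractEdges_cons, he],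
      by simp [Gen.contract, h.edges₂, contractEdges_cons, he],
      by simp [Gen.contract, h.edges₃, contractEdges_cons, he]⟩
  unfold dMuGen
  rw [h.edges₁, h.edges₂, h.edges₃]
  simp only [Multiset.map_cons, Multiset.sum_cons]
  calc _ = (muE g₁ (a, b) + muE g₃ (a, b)) + (muE g₂ (b, c) + muE g₁ (b, c)) +
        (muE g₃ (c, a) + muE g₂ (c, a)) +
        ((T.map (muE g₁)).sum + (T.map (muE g₂)).sum + (T.map (muE g₃)).sum) := by abel
    _ = 0 := by rw [k1, k2, k3, k4]; simp

lemma dWGen_arnold {a b c : ℕ} {T : Multiset (ℕ × ℕ)} {g₁ g₂ g₃ : W.Gen}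
    (h : IsArnold a b c T g₁ g₂ g₃) : dWGen g₁ + dWGen g₂ + dWGen g₃ = 0 := by
  unfold dWGen
  have e2 : g₂.ε = g₁.ε := by funext v; simp [Gen.ε, h.lab₂]
  have e3 : g₃.ε = g₁.ε := by funext v; simp [Gen.ε, h.lab₃]
  rw [h.verts₂, h.verts₃, e2, e3, ← Finset.sum_add_distrib, ← Finset.sum_add_distrib]
  refine Finset.sum_eq_zero fun x _ => ?_
  rw [← smul_add, ← smul_add, cls_arnold (a := a) (b := b) (c := c) (T := T), smul_zero]
  exact ⟨h.verts₂, h.verts₃, by simp [Gen.diff, h.lab₂], by simp [Gen.diff, h.lab₃],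
    h.edges₁, h.edges₂, h.edges₃⟩

/-! #### Multilinearity -/

lemma IsLin.ε_eq {x : ℕ} {r s : ℚ} {g g' g'' : W.Gen} (h : IsLin x r s g g' g'') :
    (∀ v ∈ g.verts, g'.ε v = g.ε v) ∧ ∀ v ∈ g.verts, g''.ε v = g.ε v := by
  constructor <;> intro v hv <;> by_cases hvx : v = x
  · subst hvx; simp [Gen.ε, Hom.par, h.deg]
  · simp [Gen.ε, h.lab v hv hvx]
  · subst hvx; simp [Gen.ε, Hom.par, h.deg']
  · simp [Gen.ε, h.lab' v hv hvx]

lemma muE_lin {x : ℕ} {r s : ℚ} {g g' g'' : W.Gen} (h : IsLin x r s g g' g'') {e : ℕ × ℕ}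
    (he : e ∈ g.edges) : muE g'' e = r • muE g e + s • muE g' e := by
  have he' : e ∈ g'.edges := by rwa [h.edges]
  have he'' : e ∈ g''.edges := by rwa [h.edges']
  obtain ⟨hi, hj⟩ := g.tree.mem e he
  have hij := g.tree.ne he
  rw [muE_of_mem he, muE_of_mem he', muE_of_mem he'', h.verts, h.verts',
    muSign_congr h.ε_eq.1 hi hj, muSign_congr h.ε_eq.2 hi hj, smul_comm r, smul_comm s,
    ← smul_add]
  congr 1
  by_cases hx : x = e.1 ∨ x = e.2
  · refine cls_lin (x := e.1) ⟨by simp [Gen.contract, hij, hi], by simp [Gen.contract, h.verts],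
      by simp [Gen.contract, h.verts'], by simp [Gen.contract, h.edges],
      by simp [Gen.contract, h.edges'], ?_, ?_, ?_, ?_, ?_⟩
    · intro v hv hv1
      simp only [Gen.contract, Finset.mem_erase] at hv
      simp only [Gen.contract, Function.update_of_ne hv1]
      refine h.lab v hv.2 ?_
      rintro rfl; tauto
    · intro v hv hv1
      simp only [Gen.contract, Finset.mem_erase] at hv
      simp only [Gen.contract, Function.update_of_ne hv1]
      refine h.lab' v hv.2 ?_
      rintro rfl; tauto
    · simp only [Gen.contract, Function.update_self, Hom.mul]
      rcases hx with rfl | rfl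
      · rw [h.deg, h.lab _ hj hij.symm]
      · rw [h.deg, h.lab _ hi hij]
    · simp only [Gen.contract, Function.update_self, Hom.mul]
      rcases hx with rfl | rfl
      · rw [h.deg', h.lab' _ hj hij.symm]
      · rw [h.deg', h.lab' _ hi hij]
    · simp only [Gen.contract, Function.update_self, Hom.mul]
      rcases hx with rfl | rfl
      · rw [h.val, h.lab' _ hj hij.symm, h.lab _ hj hij.symm]; simp
      · rw [h.val, h.lab' _ hi hij, h.lab _ hi hij]; simp
  · push Not at hx
    refine cls_lin (x := x) ⟨by simp [Gen.contract, hx.2, h.mem], by simp [Gen.contract, h.verts],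
      by simp [Gen.contract, h.verts'], by simp [Gen.contract, h.edges],
      by simp [Gen.contract, h.edges'], ?_, ?_, ?_, ?_, ?_⟩
    · intro v hv hv1
      simp only [Gen.contract, Finset.mem_erase] at hv
      simp only [Gen.contract]
      rw [h.lab _ hi hx.1.symm, h.lab _ hj hx.2.symm]
      by_cases hve : v = e.1
      · subst hve; simp
      · simp [hve, h.lab v hv.2 hv1]
    · intro v hv hv1
      simp only [Gen.contract, Finset.mem_erase] at hv
      simp only [Gen.contract]
      rw [h.lab' _ hi hx.1.symm, h.lab' _ hj hx.2.symm]
      by_cases hve : v = e.1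
      · subst hve; simp
      · simp [hve, h.lab' v hv.2 hv1]
    · simp [Gen.contract, hx.1, h.deg]
    · simp [Gen.contract, hx.1, h.deg']
    · simp [Gen.contract, hx.1, h.val]

lemma dMuGen_lin {x : ℕ} {r s : ℚ} {g g' g'' : W.Gen} (h : IsLin x r s g g' g'') :
    dMuGen g'' = r • dMuGen g + s • dMuGen g' := by
  unfold dMuGen
  rw [h.edges, h.edges', Multiset.smul_sum, Multiset.smul_sum, Multiset.map_map,
    Multiset.map_map, ← Multiset.sum_map_add]
  exact congrArg _ (Multiset.map_congr rfl fun e he => muE_lin h he)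

lemma dWGen_lin {x : ℕ} {r s : ℚ} {g g' g'' : W.Gen} (h : IsLin x r s g g' g'') :
    dWGen g'' = r • dWGen g + s • dWGen g' := by
  unfold dWGen
  rw [h.verts, h.verts', Finset.smul_sum, Finset.smul_sum, ← Finset.sum_add_distrib]
  refine Finset.sum_congr rfl fun y hy => ?_
  rw [before_congr h.ε_eq.1, before_congr h.ε_eq.2, smul_comm r, smul_comm s, ← smul_add]
  congr 1
  refine cls_lin (x := x) ⟨h.mem, h.verts, h.verts', h.edges, h.edges', ?_, ?_, ?_, ?_, ?_⟩
  · intro v hv hvx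
    by_cases hvy : v = y
    · subst hvy; simp [Gen.diff, h.lab v hv hvx]
    · simp [Gen.diff, hvy, h.lab v hv hvx]
  · intro v hv hvx
    by_cases hvy : v = y
    · subst hvy; simp [Gen.diff, h.lab' v hv hvx]
    · simp [Gen.diff, hvy, h.lab' v hv hvx]
  all_goals by_cases hxy : x = y
  · subst hxy; simp [Gen.diff, Hom.d, h.deg]
  · simp [Gen.diff, hxy, h.deg]
  · subst hxy; simp [Gen.diff, Hom.d, h.deg']
  · simp [Gen.diff, hxy, h.deg']
  · subst hxy; simp [Gen.diff, Hom.d, h.val]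
  · simp [Gen.diff, hxy, h.val]

/-- A function on labelled trees respecting the relations induces a linear map on `𝔼`. -/
noncomputable def liftEE {M : Type*} [AddCommGroup M] [Module ℚ M] (φ : W.Gen → M)
    (hlin : ∀ {x : ℕ} {r s : ℚ} {g g' g'' : W.Gen}, IsLin x r s g g' g'' →
      φ g'' = r • φ g + s • φ g')
    (hperm : ∀ {f : ℕ → ℕ} {g g' : W.Gen}, IsRelabel f g g' →
      φ g = sgn (koszul f g.verts g.ε) • φ g')
    (hrev : ∀ {i j : ℕ} {T : Multiset (ℕ × ℕ)} {g g' : W.Gen}, IsReverse i j T g g' →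
      φ g + φ g' = 0)
    (harn : ∀ {a b c : ℕ} {T : Multiset (ℕ × ℕ)} {g₁ g₂ g₃ : W.Gen},
      IsArnold a b c T g₁ g₂ g₃ → φ g₁ + φ g₂ + φ g₃ = 0) : W.EE →ₗ[ℚ] M :=
  Submodule.liftQ _ (Finsupp.linearCombination ℚ φ) (by
    rw [Submodule.span_le]
    rintro x (hx | hx | hx | hx)
    · simp [hlin hx]
    · simp [hperm hx]
    · simpa using hrev hx
    · simpa using harn hx)

variable (W)

/-- The differential `d_μ`. -/
noncomputable def dMu : W.EE →ₗ[ℚ] W.EE :=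
  liftEE dMuGen dMuGen_lin dMuGen_perm dMuGen_rev dMuGen_arnold

/-- The differential `d_W`. -/
noncomputable def dW : W.EE →ₗ[ℚ] W.EE :=
  liftEE dWGen dWGen_lin dWGen_perm dWGen_rev dWGen_arnold

variable {W}

lemma dMu_cls (g : W.Gen) : W.dMu g.cls = dMuGen g := by
  simp [dMu, liftEE, Gen.cls]

lemma dW_cls (g : W.Gen) : W.dW g.cls = dWGen g := by
  simp [dW, liftEE, Gen.cls]

end AugCDGA

namespace AugCDGA

variable {W : AugCDGA.{u}}

/-! #### The differentials square to zero and anticommute -/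

lemma before_update {S : Finset ℕ} {ε : ℕ → ZMod 2} {x : ℕ} (hx : x ∈ S) (c : ZMod 2) (y : ℕ) :
    before S (Function.update ε x (ε x + c)) y = before S ε y + ltInd x y * c := by
  obtain ⟨R, hxR, rfl⟩ : ∃ R : Finset ℕ, x ∉ R ∧ S = insert x R :=
    ⟨S.erase x, by simp, by rw [Finset.insert_erase hx]⟩
  rw [before_eq, before_eq, Finset.sum_insert hxR, Finset.sum_insert hxR, Function.update_self]
  have : ∑ u ∈ R, ltInd u y * Function.update ε x (ε x + c) u = ∑ u ∈ R, ltInd u y * ε u :=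
    Finset.sum_congr rfl fun k hk => by
      rw [Function.update_of_ne (fun h : k = x => hxR (h ▸ hk))]
  rw [this]; ring

lemma neg_of_sgn {a b : ZMod 2} {x : W.EE} (h : a + b = 1) : sgn a • x + sgn b • x = 0 := by
  have : b = a + 1 := by grind
  rw [← add_smul, this, sgn_add, sgn_one]; simp

lemma dW_dW (x : W.EE) : W.dW (W.dW x) = 0 := by
  suffices h : W.dW ∘ₗ W.dW = 0 from LinearMap.congr_fun h x
  refine Submodule.linearMap_qext _ (Finsupp.lhom_ext' fun g => LinearMap.ext_ring ?_)
  change W.dW (W.dW g.cls) = 0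
  rw [dW_cls, dWGen, map_sum]
  simp only [map_smul, dW_cls]
  simp only [dWGen, Finset.smul_sum, smul_smul, ← sgn_add]
  change ∑ x ∈ g.verts, ∑ y ∈ g.verts, sgn (before g.verts g.ε x +
    before g.verts (g.diff x).ε y) • ((g.diff x).diff y).cls = 0
  have anti : ∀ x ∈ g.verts, ∀ y ∈ g.verts,
      sgn (before g.verts g.ε x + before g.verts (g.diff x).ε y) • ((g.diff x).diff y).cls =
      - sgn (before g.verts g.ε y + before g.verts (g.diff y).ε x) • ((g.diff y).diff x).cls := by
    intro x hx y hy
    by_cases hxy : x = y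
    · subst hxy
      rw [cls_zero (g := (g.diff x).diff x) x hx (by simp [Gen.diff, Hom.d, W.d_d])]
      simp
    · rw [cls_congr (g := (g.diff y).diff x) (g' := (g.diff x).diff y) rfl rfl (fun v _ => by
        simp [Gen.diff, hxy, Ne.symm hxy]
        rw [Function.update_comm (Ne.symm hxy)])]
      rw [neg_smul, eq_neg_iff_add_eq_zero]
      apply neg_of_sgn
      rw [diff_ε, diff_ε, before_update hx, before_update hy, ltInd_symm hxy]
      grind
  have h2 : ∀ s : W.EE, s = -s → s = 0 := fun s hs => by
    have h3 : (2 : ℚ) • s = 0 := by rw [two_smul, ← eq_neg_iff_add_eq_zero]; exact hs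
    exact (smul_eq_zero.1 h3).resolve_left two_ne_zero
  apply h2
  conv_rhs => rw [Finset.sum_comm]
  rw [← Finset.sum_neg_distrib]
  refine Finset.sum_congr rfl fun x hx => ?_
  rw [← Finset.sum_neg_distrib]
  refine Finset.sum_congr rfl fun y hy => ?_
  rw [anti x hx y hy, neg_smul]

lemma sum_multiset_comm {α M : Type*} [AddCommMonoid M] (S : Finset ℕ) (E : Multiset α)
    (f : ℕ → α → M) : ∑ x ∈ S, (E.map (f x)).sum = (E.map fun e => ∑ x ∈ S, f x e).sum := by
  induction E using Multiset.induction_on with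
  | empty => simp
  | cons a E ih => simp [Finset.sum_add_distrib, ih]

lemma muSign_update {S : Finset ℕ} {ε : ℕ → ZMod 2} {i j x : ℕ} (hi : i ∈ S)
    (hj : j ∈ S) (hij : i ≠ j) (hx : x ∈ S) :
    muSign S (Function.update ε x (ε x + 1)) i j = muSign S ε i j +
      (if x = i then 1 + ltInd j i * ε j else
       if x = j then ltInd j i * ε i + before (S.erase j) ε j + before (S.erase j) ε i +
          ltInd i j * ε i
       else ε j * (ltInd x j + ltInd x i) + ltInd x i) := by
  obtain ⟨R, hiR, hjR, rfl⟩ := exists_split hi hj hij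
  have h2 : (insert i (insert j R)).erase j = insert i R := by
    rw [Finset.insert_comm, Finset.erase_insert]; simp [hij.symm, hjR]
  rw [muSign_insert hij hiR hjR, muSign_insert hij hiR hjR, h2, before_eq, before_eq,
    Finset.sum_insert hiR, Finset.sum_insert hiR]
  have hne : ∀ k ∈ R, k ≠ i ∧ k ≠ j := fun k hk => ⟨fun h => hiR (h ▸ hk), fun h => hjR (h ▸ hk)⟩
  by_cases hxi : x = i
  · subst hxi
    rw [if_pos rfl, Function.update_self, Function.update_of_ne hij.symm]
    have : ∑ k ∈ R, Function.update ε x (ε x + 1) k * (ε j * (ltInd k j + ltInd k x) + ltInd k x)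
      = ∑ k ∈ R, ε k * (ε j * (ltInd k j + ltInd k x) + ltInd k x) :=
      Finset.sum_congr rfl fun k hk => by rw [Function.update_of_ne (hne k hk).1]
    rw [this]; ring
  · rw [if_neg hxi]
    by_cases hxj : x = j
    · subst hxj
      rw [if_pos rfl, Function.update_self, Function.update_of_ne hij]
      have : ∑ k ∈ R, Function.update ε x (ε x + 1) k *
        ((ε x + 1) * (ltInd k x + ltInd k i) + ltInd k i)
        = ∑ k ∈ R, ε k * (ε x * (ltInd k x + ltInd k i) + ltInd k i) +
          (∑ k ∈ R, ltInd k x * ε k + ∑ k ∈ R, ltInd k i * ε k) := by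
        simp only [← Finset.sum_add_distrib]
        exact Finset.sum_congr rfl fun k hk => by
          rw [Function.update_of_ne (hne k hk).2]; ring
      rw [this, ltInd_self]; grind
    · rw [if_neg hxj]
      have hxR : x ∈ R := by simpa [hxi, hxj] using hx
      rw [Function.update_of_ne (Ne.symm hxi), Function.update_of_ne (Ne.symm hxj),
        Finset.sum_eq_add_sum_sdiff_singleton_of_mem hxR,
        Finset.sum_eq_add_sum_sdiff_singleton_of_mem hxR (fun k => ε k * _), Function.update_self]
      have : ∑ k ∈ R \ {x}, Function.update ε x (ε x + 1) k *
          (ε j * (ltInd k j + ltInd k i) + ltInd k i)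
        = ∑ k ∈ R \ {x}, ε k * (ε j * (ltInd k j + ltInd k i) + ltInd k i) :=
        Finset.sum_congr rfl fun k hk => by
          rw [Function.update_of_ne (by simp at hk; exact hk.2)]
      rw [this]; ring

lemma before_erase {S : Finset ℕ} {ε : ℕ → ZMod 2} {j : ℕ} (hj : j ∈ S) (y : ℕ) :
    before (S.erase j) ε y = before S ε y + ltInd j y * ε j := by
  obtain ⟨R, hxR, rfl⟩ : ∃ R : Finset ℕ, j ∉ R ∧ S = insert j R :=
    ⟨S.erase j, by simp, by rw [Finset.insert_erase hj]⟩
  rw [Finset.erase_insert hxR, before_eq, before_eq, Finset.sum_insert hxR]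
  grind

lemma add_aux {M : Type*} [AddCommGroup M] {a b c d e f : M} (h1 : a + d = 0) (h2 : b + e = 0)
    (h3 : c + f = 0) : a + (b + c) + (d + e + f) = 0 := by
  rw [show a + (b + c) + (d + e + f) = (a + d) + (b + e) + (c + f) by abel, h1, h2, h3]; simp

lemma dW_dMu_edge (g : W.Gen) {e : ℕ × ℕ} (he : e ∈ g.edges) :
    ∑ x ∈ g.verts, sgn (before g.verts g.ε x) • muE (g.diff x) e +
      sgn (muSign g.verts g.ε e.1 e.2) • dWGen (g.contract e he) = 0 := by
  obtain ⟨i, j⟩ := e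
  obtain ⟨hi, hj⟩ := g.tree.mem _ he
  have hij : i ≠ j := g.tree.ne he
  simp only at hi hj ⊢
  have hm : ∀ x, muE (g.diff x) (i, j) = sgn (muSign g.verts (g.diff x).ε i j) •
      ((g.diff x).contract (i, j) he).cls := fun x => muE_of_mem (g := g.diff x) he
  simp only [hm]
  obtain ⟨R, hiR, hjR, hS⟩ := exists_split hi hj hij
  have hE : g.verts.erase j = insert i R := by
    rw [hS, Finset.insert_comm, Finset.erase_insert]; simp [hij.symm, hjR]
  have hne : ∀ k ∈ R, k ≠ i ∧ k ≠ j := fun k hk => ⟨fun h => hiR (h ▸ hk), fun h => hjR (h ▸ hk)⟩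
  have hiE : i ∈ g.verts.erase j := by simp [hij, hi]
  have bi : before (g.verts.erase j) (g.contract (i, j) he).ε i =
      before (g.verts.erase j) g.ε i := by
    rw [contract_ε]
    change before _ (Function.update g.ε i (g.ε i + g.ε j + 1)) i = _
    rw [add_assoc, before_update hiE, ltInd_self]; ring
  -- the terms at vertices not on the edge
  have hR : ∀ x ∈ R, sgn (before g.verts g.ε x) • sgn (muSign g.verts (g.diff x).ε i j) •
      ((g.diff x).contract (i, j) he).cls + sgn (muSign g.verts g.ε i j) •
      sgn (before (g.verts.erase j) (g.contract (i, j) he).ε x) •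
        ((g.contract (i, j) he).diff x).cls = 0 := by
    intro x hx
    obtain ⟨hxi, hxj⟩ := hne x hx
    have hxS : x ∈ g.verts := by rw [hS]; simp [hx]
    rw [cls_congr (g := (g.contract (i, j) he).diff x) (g' := (g.diff x).contract (i, j) he) rfl rfl
      (fun v _ => by
        simp [Gen.diff, Gen.contract, hxi, Ne.symm hxi, Ne.symm hxj]
        rw [Function.update_comm hxi])]
    rw [smul_smul, smul_smul, ← sgn_add, ← sgn_add]
    apply neg_of_sgn
    rw [diff_ε, muSign_update hi hj hij hxS, if_neg hxi, if_neg hxj, contract_ε]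
    change _ + (_ + before _ (Function.update g.ε i (g.ε i + g.ε j + 1)) x) = _
    rw [add_assoc (g.ε i), before_update hiE, before_erase hj, ltInd_symm (Ne.symm hxi),
      ltInd_symm (Ne.symm hxj)]
    grind
  have hL : ((g.contract (i, j) he).diff i).cls = (1 : ℚ) • ((g.diff i).contract (i, j) he).cls +
      sgn (g.ε i + 1) • ((g.diff j).contract (i, j) he).cls := by
    refine cls_lin (x := i) ⟨hiE, rfl, rfl, rfl, rfl, ?_, ?_, ?_, ?_, ?_⟩
    · intro v hv hvi
      have hvj : v ≠ j := by simp [Gen.contract] at hv; exact hv.1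
      simp [Gen.contract, Gen.diff, hvi, hvj]
    · intro v hv hvi
      simp [Gen.contract, Gen.diff, hvi]
    · simp [Gen.contract, Gen.diff, hij, hij.symm, Hom.mul, Hom.d]; ring
    · simp [Gen.contract, Gen.diff, hij.symm, Hom.mul, Hom.d]; ring
    · simp only [Gen.contract, Gen.diff, Hom.mul, Hom.d, Function.update_self,
        Function.update_of_ne hij, Function.update_of_ne hij.symm, one_smul]
      rw [W.d_mul _ (g.lab i).mem, Hom.deg_cast]
      rfl
  rw [dWGen]
  change _ + _ • ∑ x ∈ g.verts.erase j, _ • _ = _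
  rw [hE, Finset.sum_insert hiR]
  conv_lhs => enter [1, 1]; rw [hS]
  rw [Finset.sum_insert (by simp [hij, hiR]), Finset.sum_insert hjR, smul_add, Finset.smul_sum]
  rw [show (g.contract (i, j) he).verts = g.verts.erase j from rfl, bi, hL]
  have t1 : sgn (before g.verts g.ε i) • sgn (muSign g.verts (g.diff i).ε i j) •
      ((g.diff i).contract (i, j) he).cls + sgn (muSign g.verts g.ε i j) •
      sgn (before (g.verts.erase j) g.ε i) • (1 : ℚ) • ((g.diff i).contract (i, j) he).cls = 0 := by
    rw [one_smul, smul_smul, smul_smul, ← sgn_add, ← sgn_add]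
    apply neg_of_sgn
    rw [diff_ε, muSign_update hi hj hij hi, if_pos rfl, before_erase hj]
    grind
  have t2 : sgn (before g.verts g.ε j) • sgn (muSign g.verts (g.diff j).ε i j) •
      ((g.diff j).contract (i, j) he).cls + sgn (muSign g.verts g.ε i j) •
      sgn (before (g.verts.erase j) g.ε i) • sgn (g.ε i + 1) •
        ((g.diff j).contract (i, j) he).cls = 0 := by
    rw [smul_smul, smul_smul, smul_smul, ← sgn_add, ← sgn_add, ← sgn_add]
    apply neg_of_sgn
    rw [diff_ε, muSign_update hi hj hij hj, if_neg hij.symm, if_pos rfl, before_erase hj,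
      before_erase hj, ltInd_self, ltInd_symm hij]
    grind
  have t3 := Finset.sum_eq_zero hR
  rw [Finset.sum_add_distrib] at t3
  simp only [smul_add]
  exact add_aux t1 t2 t3

lemma dW_dMu (x : W.EE) : W.dMu (W.dW x) + W.dW (W.dMu x) = 0 := by
  suffices h : W.dMu ∘ₗ W.dW + W.dW ∘ₗ W.dMu = 0 from LinearMap.congr_fun h x
  refine Submodule.linearMap_qext _ (Finsupp.lhom_ext' fun g => LinearMap.ext_ring ?_)
  change W.dMu (W.dW g.cls) + W.dW (W.dMu g.cls) = 0
  rw [dW_cls, dMu_cls, dWGen, dMuGen, map_sum, map_multiset_sum, Multiset.map_map]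
  simp only [map_smul, dMu_cls]
  simp only [dMuGen, Multiset.smul_sum, Multiset.map_map]
  change ∑ x ∈ g.verts, (Multiset.map _ g.edges).sum + _ = _
  rw [sum_multiset_comm, ← Multiset.sum_map_add]
  refine Multiset.sum_eq_zero fun x hx => ?_
  obtain ⟨e, he, rfl⟩ := Multiset.mem_map.1 hx
  simp only [Function.comp]
  rw [muE_of_mem he, map_smul, dW_cls]
  exact dW_dMu_edge g he

end AugCDGA

namespace AugCDGA

variable {W : AugCDGA.{u}}

lemma exists_split3 {S : Finset ℕ} {i j k : ℕ} (hi : i ∈ S) (hj : j ∈ S) (hk : k ∈ S) (hij : i ≠ j)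
    (hik : i ≠ k) (hjk : j ≠ k) :
    ∃ R : Finset ℕ, i ∉ R ∧ j ∉ R ∧ k ∉ R ∧ S = insert i (insert j (insert k R)) := by
  refine ⟨((S.erase i).erase j).erase k, by simp, by simp, by simp, ?_⟩
  rw [Finset.insert_erase, Finset.insert_erase, Finset.insert_erase hi] <;>
    simp [hj, hk, hij.symm, hik.symm, hjk.symm]

lemma sum_update {R : Finset ℕ} {ε : ℕ → ZMod 2} {i : ℕ} (hi : i ∉ R) (c : ZMod 2)
    (f : ℕ → ZMod 2) : ∑ k ∈ R, Function.update ε i c k * f k = ∑ k ∈ R, ε k * f k :=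
  Finset.sum_congr rfl fun k hk => by rw [Function.update_of_ne (fun h : k = i => hi (h ▸ hk))]

lemma sign_path {S : Finset ℕ} {ε : ℕ → ZMod 2} {i j k : ℕ} (hi : i ∈ S) (hj : j ∈ S) (hk : k ∈ S)
    (hij : i ≠ j) (hik : i ≠ k) (hjk : j ≠ k) :
    muSign S ε i j + muSign (S.erase j) (Function.update ε i (ε i + ε j + 1)) i k +
      (muSign S ε j k + muSign (S.erase k) (Function.update ε j (ε j + ε k + 1)) i j) = 1 := by
  obtain ⟨R, hiR, hjR, hkR, rfl⟩ := exists_split3 hi hj hk hij hik hjk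
  have e1 : (insert i (insert j (insert k R))).erase j = insert i (insert k R) := by
    rw [Finset.insert_comm, Finset.erase_insert]; simp [hij.symm, hjk, hjR]
  have e2 : (insert i (insert j (insert k R))).erase k = insert i (insert j R) := by
    rw [Finset.insert_comm j k, Finset.insert_comm i k, Finset.erase_insert]
    simp [hik.symm, hjk.symm, hkR]
  have e3 : insert i (insert j (insert k R)) = insert j (insert k (insert i R)) := by
    ext v; simp; tauto
  rw [e1, e2, muSign_insert hij (by simp [hik, hiR]) (by simp [hjk, hjR]), muSign_insert hik hiR hkR,
    muSign_insert hij hiR hjR, e3, muSign_insert hjk (by simp [hij.symm, hjR])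
      (by simp [hik.symm, hkR]), Finset.sum_insert hkR, Finset.sum_insert hiR]
  simp only [Function.update_self, Function.update_of_ne hik.symm, Function.update_of_ne hij,
    sum_update hiR, sum_update hjR]
  have key : ∑ l ∈ R, ε l * (ε j * (ltInd l j + ltInd l i) + ltInd l i) +
     ∑ l ∈ R, ε l * (ε k * (ltInd l k + ltInd l i) + ltInd l i) +
     (∑ l ∈ R, ε l * (ε k * (ltInd l k + ltInd l j) + ltInd l j) +
     ∑ l ∈ R, ε l * ((ε j + ε k + 1) * (ltInd l j + ltInd l i) + ltInd l i)) = 0 := by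
    simp only [← Finset.sum_add_distrib]
    exact Finset.sum_eq_zero fun l _ => by grind
  rw [ltInd_symm hij, ltInd_symm hik]
  have sq : ∀ x : ZMod 2, x * x = x := by decide
  have := sq (ε i); have := sq (ε j); have := sq (ε k)
  grind

lemma sign_out {S : Finset ℕ} {ε : ℕ → ZMod 2} {i j k : ℕ} (hi : i ∈ S) (hj : j ∈ S) (hk : k ∈ S)
    (hij : i ≠ j) (hik : i ≠ k) (hjk : j ≠ k) :
    muSign S ε i j + muSign (S.erase j) (Function.update ε i (ε i + ε j + 1)) i k +
      (muSign S ε i k + muSign (S.erase k) (Function.update ε i (ε i + ε k + 1)) i j) +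
      (ε j + 1) * (ε k + 1) = 1 := by
  obtain ⟨R, hiR, hjR, hkR, rfl⟩ := exists_split3 hi hj hk hij hik hjk
  have e1 : (insert i (insert j (insert k R))).erase j = insert i (insert k R) := by
    rw [Finset.insert_comm, Finset.erase_insert]; simp [hij.symm, hjk, hjR]
  have e2 : (insert i (insert j (insert k R))).erase k = insert i (insert j R) := by
    rw [Finset.insert_comm j k, Finset.insert_comm i k, Finset.erase_insert]
    simp [hik.symm, hjk.symm, hkR]
  have e3 : insert i (insert j (insert k R)) = insert i (insert k (insert j R)) := by
    ext v; simp; tauto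
  rw [e1, e2, muSign_insert hij (by simp [hik, hiR]) (by simp [hjk, hjR]), muSign_insert hik hiR hkR,
    muSign_insert hij hiR hjR, e3, muSign_insert hik (by simp [hij, hiR])
      (by simp [hjk.symm, hkR]), Finset.sum_insert hkR, Finset.sum_insert hjR]
  simp only [Function.update_self, Function.update_of_ne hik.symm, Function.update_of_ne hij.symm,
    sum_update hiR]
  have key : ∑ l ∈ R, ε l * (ε j * (ltInd l j + ltInd l i) + ltInd l i) +
     ∑ l ∈ R, ε l * (ε k * (ltInd l k + ltInd l i) + ltInd l i) +
     (∑ l ∈ R, ε l * (ε k * (ltInd l k + ltInd l i) + ltInd l i) +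
     ∑ l ∈ R, ε l * (ε j * (ltInd l j + ltInd l i) + ltInd l i)) = 0 := by
    simp only [← Finset.sum_add_distrib]
    exact Finset.sum_eq_zero fun l _ => by grind
  rw [ltInd_symm hjk]
  grind

lemma sign_in {S : Finset ℕ} {ε : ℕ → ZMod 2} {i j k : ℕ} (hi : i ∈ S) (hj : j ∈ S) (hk : k ∈ S)
    (hij : i ≠ j) (hik : i ≠ k) (hjk : j ≠ k) {η : ℕ → ZMod 2}
    (hη : ∀ v ∈ S, v ≠ i → v ≠ k → η v = ε v) (hηk : η i = ε i + ε j + ε k) :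
    muSign S ε i j + muSign (S.erase j) (Function.update ε i (ε i + ε j + 1)) k i +
      (muSign S ε k j + muSign (S.erase j) (Function.update ε k (ε k + ε j + 1)) i k) +
      (ε i + 1) * (ε k + 1) +
      koszul (Equiv.swap i k) ((S.erase j).erase k) η = 1 := by
  obtain ⟨R, hiR, hjR, hkR, rfl⟩ := exists_split3 hi hj hk hij hik hjk
  have hne : ∀ l ∈ R, l ≠ i ∧ l ≠ k := fun l hl => ⟨fun h => hiR (h ▸ hl), fun h => hkR (h ▸ hl)⟩
  have hsw : ∀ l ∈ R, Equiv.swap i k l = l := fun l hl =>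
    Equiv.swap_apply_of_ne_of_ne (hne l hl).1 (hne l hl).2
  have e1 : (insert i (insert j (insert k R))).erase j = insert i (insert k R) := by
    rw [Finset.insert_comm, Finset.erase_insert]; simp [hij.symm, hjk, hjR]
  have e2 : (insert i (insert k R)).erase k = insert i R := by
    rw [Finset.insert_comm i k, Finset.erase_insert]
    simp [hik.symm, hkR]
  have e3 : insert i (insert j (insert k R)) = insert k (insert j (insert i R)) := by
    ext v; simp; tauto
  rw [e1, e2, muSign_insert hij (by simp [hik, hiR]) (by simp [hjk, hjR]), muSign_insert hik hiR hkR,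
    Finset.insert_comm i k, muSign_insert hik.symm hkR hiR,
    e3, muSign_insert hjk.symm (by simp [hik.symm, hkR])
      (by simp [hij.symm, hjR]), Finset.sum_insert hkR, Finset.sum_insert hiR,
    koszul_insert hiR (Equiv.injective _).injOn, koszul_fix hsw, Equiv.swap_apply_left, hηk]
  simp only [Function.update_self, Function.update_of_ne hik.symm, Function.update_of_ne hik,
    sum_update hiR, sum_update hkR]
  have key : ∑ l ∈ R, ε l * (ε j * (ltInd l j + ltInd l i) + ltInd l i) +
     ∑ l ∈ R, ε l * ((ε i + ε j + 1) * (ltInd l i + ltInd l k) + ltInd l k) +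
     (∑ l ∈ R, ε l * (ε j * (ltInd l j + ltInd l k) + ltInd l k) +
     ∑ l ∈ R, ε l * ((ε k + ε j + 1) * (ltInd l k + ltInd l i) + ltInd l i)) +
     ∑ l ∈ R, (ε i + ε j + ε k) * η l * (ltInd l i + ltInd (Equiv.swap i k l) k) = 0 := by
    simp only [← Finset.sum_add_distrib]
    exact Finset.sum_eq_zero fun l hl => by
      rw [hsw l hl, hη l (by simp [hl]) (hne l hl).1 (hne l hl).2]; grind
  rw [ltInd_symm hij, ltInd_symm hik, ltInd_symm hjk]
  revert key
  generalize ∑ l ∈ R, ε l * (ε j * (ltInd l j + ltInd l i) + ltInd l i) = A1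
  generalize ∑ l ∈ R, ε l * ((ε i + ε j + 1) * (ltInd l i + ltInd l k) + ltInd l k) = A2
  generalize ∑ l ∈ R, ε l * (ε j * (ltInd l j + ltInd l k) + ltInd l k) = A3
  generalize ∑ l ∈ R, ε l * ((ε k + ε j + 1) * (ltInd l k + ltInd l i) + ltInd l i) = A4
  generalize ∑ l ∈ R, (ε i + ε j + ε k) * η l * (ltInd l i + ltInd (Equiv.swap i k l) k) = A5
  intro key
  clear hη hηk hne hsw e1 e2 e3 hi hj hk
  have sq : ∀ x : ZMod 2, x * x = x := by decide
  have := sq (ε i); have := sq (ε j); have := sq (ε k)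
  grind

lemma sign_disj {S : Finset ℕ} {ε : ℕ → ZMod 2} {i j k l : ℕ} (hi : i ∈ S) (hj : j ∈ S)
    (hk : k ∈ S) (hl : l ∈ S) (hij : i ≠ j) (hik : i ≠ k) (hil : i ≠ l) (hjk : j ≠ k)
    (hjl : j ≠ l) (hkl : k ≠ l) :
    muSign S ε i j + muSign (S.erase j) (Function.update ε i (ε i + ε j + 1)) k l +
      (muSign S ε k l + muSign (S.erase l) (Function.update ε k (ε k + ε l + 1)) i j) = 1 := by
  obtain ⟨R, hiR, hjR, hkR, hS⟩ := exists_split3 hi hj hk hij hik hjk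
  obtain ⟨Q, hlQ, rfl⟩ : ∃ Q : Finset ℕ, l ∉ Q ∧ R = insert l Q := by
    refine ⟨R.erase l, by simp, ?_⟩
    rw [Finset.insert_erase]
    rw [hS] at hl; simpa [hil.symm, hjl.symm, hkl.symm] using hl
  simp only [Finset.mem_insert, not_or] at hiR hjR hkR
  obtain ⟨-, hiR⟩ := hiR
  obtain ⟨-, hjR⟩ := hjR
  obtain ⟨-, hkR⟩ := hkR
  subst hS
  have e1 : (insert i (insert j (insert k (insert l Q)))).erase j =
      insert k (insert l (insert i Q)) := by
    ext v; simp only [Finset.mem_erase, Finset.mem_insert]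
    constructor
    · tauto
    · rintro (rfl | rfl | rfl | h) <;> simp_all [Ne.symm]
      rintro rfl; exact hjR h
  have e2 : (insert i (insert j (insert k (insert l Q)))).erase l =
      insert i (insert j (insert k Q)) := by
    ext v; simp only [Finset.mem_erase, Finset.mem_insert]
    constructor
    · tauto
    · rintro (rfl | rfl | rfl | h) <;> simp_all [Ne.symm]
      rintro rfl; exact hlQ h
  have e3 : insert i (insert j (insert k (insert l Q))) =
      insert k (insert l (insert i (insert j Q))) := by
    ext v; simp; tauto
  rw [e1, e2, muSign_insert hij (by simp [hik, hil, hiR]) (by simp [hjk, hjl, hjR]),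
    muSign_insert hkl (by simp [hik.symm, hkR]) (by simp [hil.symm, hlQ]),
    muSign_insert hij (by simp [hik, hiR]) (by simp [hjk, hjR]), e3,
    muSign_insert hkl (by simp [hik.symm, hjk.symm, hkR]) (by simp [hil.symm, hjl.symm, hlQ]),
    Finset.sum_insert (by simp [hkl, hkR]), Finset.sum_insert hlQ, Finset.sum_insert hiR,
    Finset.sum_insert hkR, Finset.sum_insert (by simp [hij, hiR]), Finset.sum_insert hjR]
  simp only [Function.update_self, Function.update_of_ne hik.symm, Function.update_of_ne hil.symm,
    Function.update_of_ne hik, Function.update_of_ne hjk, sum_update hiR, sum_update hkR]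
  have key : ∑ m ∈ Q, ε m * (ε j * (ltInd m j + ltInd m i) + ltInd m i) +
     ∑ m ∈ Q, ε m * (ε l * (ltInd m l + ltInd m k) + ltInd m k) +
     (∑ m ∈ Q, ε m * (ε l * (ltInd m l + ltInd m k) + ltInd m k) +
     ∑ m ∈ Q, ε m * (ε j * (ltInd m j + ltInd m i) + ltInd m i)) = 0 := by
    simp only [← Finset.sum_add_distrib]
    exact Finset.sum_eq_zero fun l _ => by grind
  rw [ltInd_symm hik, ltInd_symm hil, ltInd_symm hjk, ltInd_symm hjl]
  grind

open Classical in
/-- Two successive contractions. -/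
noncomputable def muE2 (g : W.Gen) (e e' : ℕ × ℕ) : W.EE :=
  if he : e ∈ g.edges then sgn (muSign g.verts g.ε e.1 e.2) •
    muE (g.contract e he) (Prod.map (collapse e.1 e.2) (collapse e.1 e.2) e') else 0

lemma muE2_eq {g : W.Gen} {i j k l k' l' : ℕ} (he : (i, j) ∈ g.edges)
    (hk : collapse i j k = k') (hl : collapse i j l = l')
    (he' : (k', l') ∈ (g.contract _ he).edges) :
    muE2 g (i, j) (k, l) = sgn (muSign g.verts g.ε i j + muSign (g.verts.erase j)
      (Function.update g.ε i (g.ε i + g.ε j + 1)) k' l') •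
        ((g.contract _ he).contract (k', l') he').cls := by
  unfold muE2
  rw [dif_pos he]
  simp only [Prod.map_apply, hk, hl]
  rw [muE_of_mem he', smul_smul, sgn_add, contract_ε]
  rfl

lemma contract_edges_eq {g : W.Gen} {i j k l : ℕ} {T : Multiset (ℕ × ℕ)}
    (hE : g.edges = (i, j) ::ₘ (k, l) ::ₘ T) (he : (i, j) ∈ g.edges) :
    (g.contract _ he).edges = (collapse i j k, collapse i j l) ::ₘ
      T.map (Prod.map (collapse i j) (collapse i j)) := by
  simp [Gen.contract, hE, contractEdges_cons_self]

lemma contract_contract_edges {g : W.Gen} {i j k l k' l' : ℕ} {T : Multiset (ℕ × ℕ)}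
    (hE : g.edges = (i, j) ::ₘ (k, l) ::ₘ T) (he : (i, j) ∈ g.edges)
    (hk : collapse i j k = k') (hl : collapse i j l = l')
    (he' : (k', l') ∈ (g.contract _ he).edges) :
    ((g.contract _ he).contract _ he').edges =
      T.map (Prod.map (collapse k' l' ∘ collapse i j) (collapse k' l' ∘ collapse i j)) := by
  change contractEdges (g.contract _ he).edges _ = _
  rw [contract_edges_eq hE he, hk, hl, contractEdges_cons_self, Multiset.map_map]
  rfl

lemma muE2_path {g : W.Gen} {i j k : ℕ} {T : Multiset (ℕ × ℕ)}
    (hE : g.edges = (i, j) ::ₘ (j, k) ::ₘ T) :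
    muE2 g (i, j) (j, k) + muE2 g (j, k) (i, j) = 0 := by
  have hE' : g.edges = (j, k) ::ₘ (i, j) ::ₘ T := by rw [hE, Multiset.cons_swap]
  have he : (i, j) ∈ g.edges := by rw [hE]; simp
  have he' : (j, k) ∈ g.edges := by rw [hE]; simp
  obtain ⟨hi, hj⟩ := g.tree.mem _ he
  obtain ⟨-, hk⟩ := g.tree.mem _ he'
  have hij : i ≠ j := g.tree.ne he
  have hjk : j ≠ k := g.tree.ne he'
  simp only at hi hj hk
  have c1 : collapse i j j = i := collapse_right _ _
  have c2 : collapse i j k = k := collapse_ne hjk.symm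
  have h1 : (i, k) ∈ (g.contract _ he).edges := by rw [contract_edges_eq hE he, c1, c2]; simp
  have hik : i ≠ k := (g.contract _ he).tree.ne h1
  have c3 : collapse j k i = i := collapse_ne hik
  have c4 : collapse j k j = j := collapse_left _ _
  have h2 : (i, j) ∈ (g.contract _ he').edges := by rw [contract_edges_eq hE' he', c3, c4]; simp
  rw [muE2_eq he c1 c2 h1, muE2_eq he' c3 c4 h2,
    cls_congr (g := (g.contract _ he).contract _ h1) (g' := (g.contract _ he').contract _ h2)]
  · exact neg_of_sgn (sign_path hi hj hk hij hik hjk)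
  · simp only [Gen.contract]; rw [Finset.erase_right_comm]
  · rw [contract_contract_edges hE he c1 c2 h1, contract_contract_edges hE' he' c3 c4 h2]
    have : collapse i j ∘ collapse j k = collapse i k ∘ collapse i j := by
      funext v; simp only [Function.comp, collapse]; split_ifs <;> simp_all
    rw [this]
  · intro v hv
    have hvj : v ≠ j := by simp [Gen.contract] at hv; exact hv.2.1
    by_cases hvi : v = i
    · subst hvi
      simp only [Gen.contract, Function.update_self, Function.update_of_ne hik.symm,
        Function.update_of_ne hvj]
      ext
      · simp only [Hom.mul]; ring
      · simp [Hom.mul, W.mul_assoc]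
    · simp [Gen.contract, hvi, hvj]

lemma muE2_out {g : W.Gen} {i j k : ℕ} {T : Multiset (ℕ × ℕ)}
    (hE : g.edges = (i, j) ::ₘ (i, k) ::ₘ T) :
    muE2 g (i, j) (i, k) + muE2 g (i, k) (i, j) = 0 := by
  have hE' : g.edges = (i, k) ::ₘ (i, j) ::ₘ T := by rw [hE, Multiset.cons_swap]
  have he : (i, j) ∈ g.edges := by rw [hE]; simp
  have he' : (i, k) ∈ g.edges := by rw [hE]; simp
  obtain ⟨hi, hj⟩ := g.tree.mem _ he
  obtain ⟨-, hk⟩ := g.tree.mem _ he'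
  have hij : i ≠ j := g.tree.ne he
  have hik : i ≠ k := g.tree.ne he'
  simp only at hi hj hk
  have c1 : collapse i j i = i := collapse_left _ _
  have hjk : j ≠ k := by
    rintro rfl
    have := (g.contract _ he).tree.ne (e := (i, i)) (by
      rw [contract_edges_eq hE he, c1, collapse_right]; simp)
    exact this rfl
  have c2 : collapse i j k = k := collapse_ne hjk.symm
  have h1 : (i, k) ∈ (g.contract _ he).edges := by rw [contract_edges_eq hE he, c1, c2]; simp
  have c3 : collapse i k i = i := collapse_left _ _
  have c4 : collapse i k j = j := collapse_ne hjk
  have h2 : (i, j) ∈ (g.contract _ he').edges := by rw [contract_edges_eq hE' he', c3, c4]; simp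
  rw [muE2_eq he c1 c2 h1, muE2_eq he' c3 c4 h2,
    cls_smul (g := (g.contract _ he').contract _ h2) (g'' := (g.contract _ he).contract _ h1) i
      (sgn ((g.ε j + 1) * (g.ε k + 1)))]
  · rw [smul_smul, ← sgn_add]
    refine neg_of_sgn (Eq.trans ?_ (sign_out (ε := g.ε) hi hj hk hij hik hjk)); ring
  · simp [Gen.contract, hij, hik, hi]
  · simp only [Gen.contract]; rw [Finset.erase_right_comm]
  · rw [contract_contract_edges hE he c1 c2 h1, contract_contract_edges hE' he' c3 c4 h2]
    have : collapse i j ∘ collapse i k = collapse i k ∘ collapse i j := by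
      funext v; simp only [Function.comp, collapse]; split_ifs <;> simp_all
    rw [this]
  · intro v hv hvi
    simp [Gen.contract, hvi]
  · simp only [Gen.contract, Function.update_self, Function.update_of_ne hik.symm,
        Function.update_of_ne hij.symm, Hom.mul]
    ring
  · simp only [Gen.contract, Function.update_self, Function.update_of_ne hik.symm,
        Function.update_of_ne hij.symm, Hom.mul]
    rw [W.mul_assoc, W.mul_comm (g.lab j).mem (g.lab k).mem, map_smul, W.mul_assoc,
      Hom.deg_cast, Hom.deg_cast]
    rfl

lemma muE2_in {g : W.Gen} {i j k : ℕ} {T : Multiset (ℕ × ℕ)}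
    (hE : g.edges = (i, j) ::ₘ (k, j) ::ₘ T) :
    muE2 g (i, j) (k, j) + muE2 g (k, j) (i, j) = 0 := by
  have hE' : g.edges = (k, j) ::ₘ (i, j) ::ₘ T := by rw [hE, Multiset.cons_swap]
  have he : (i, j) ∈ g.edges := by rw [hE]; simp
  have he' : (k, j) ∈ g.edges := by rw [hE]; simp
  obtain ⟨hi, hj⟩ := g.tree.mem _ he
  obtain ⟨hk, -⟩ := g.tree.mem _ he'
  have hij : i ≠ j := g.tree.ne he
  have hkj : k ≠ j := g.tree.ne he'
  simp only at hi hj hk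
  have c1 : collapse i j k = k := collapse_ne hkj
  have c2 : collapse i j j = i := collapse_right _ _
  have h1 : (k, i) ∈ (g.contract _ he).edges := by rw [contract_edges_eq hE he, c1, c2]; simp
  have hki : k ≠ i := (g.contract _ he).tree.ne h1
  have c3 : collapse k j i = i := collapse_ne hij
  have c4 : collapse k j j = k := collapse_right _ _
  have h2 : (i, k) ∈ (g.contract _ he').edges := by rw [contract_edges_eq hE' he', c3, c4]; simp
  -- relabel the second contraction so that its vertex `i` is called `k`
  have hR : IsRelabel (Equiv.swap i k) ((g.contract _ he').contract _ h2)
      ⟨((g.contract _ he).contract _ h1).verts, ((g.contract _ he).contract _ h1).edges,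
        Function.update g.lab k ((g.lab i).mul ((g.lab k).mul (g.lab j))),
        ((g.contract _ he).contract _ h1).tree⟩ := by
    refine ⟨(Equiv.injective _).injOn, ?_, ?_, ?_⟩
    · simp only [Gen.contract]
      ext v
      simp only [Finset.mem_erase, Finset.mem_image]
      constructor
      · rintro ⟨h3, h4, h5⟩
        by_cases hvk : v = k
        · exact ⟨i, ⟨hki.symm, hij, hi⟩, by simp [hvk]⟩
        · exact ⟨v, ⟨hvk, h4, h5⟩, Equiv.swap_apply_of_ne_of_ne h3 hvk⟩
      · rintro ⟨u, ⟨h3, h4, h5⟩, rfl⟩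
        by_cases hui : u = i
        · simp [hui, hki, hk, hkj]
        · rw [Equiv.swap_apply_of_ne_of_ne hui h3]; exact ⟨hui, h4, h5⟩
    · simp only
      rw [contract_contract_edges hE he c1 c2 h1, contract_contract_edges hE' he' c3 c4 h2,
        Multiset.map_map]
      have : (collapse k i ∘ collapse i j) = Equiv.swap i k ∘ (collapse i k ∘ collapse k j) := by
        funext v
        simp only [Function.comp, collapse, Equiv.swap_apply_def]; split_ifs <;> simp_all
      rw [this]; rfl
    · intro v hv
      have hvk : v ≠ k := by simp [Gen.contract] at hv; exact hv.1
      by_cases hvi : v = i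
      · subst hvi
        simp [Gen.contract, hki.symm]
      · simp only [Equiv.swap_apply_of_ne_of_ne hvi hvk]
        simp [Gen.contract, hvi, hvk]
  have hC : ((g.contract _ he).contract _ h1).cls = sgn ((g.ε i + 1) * (g.ε k + 1)) •
      Gen.cls (W := W) ⟨((g.contract _ he).contract _ h1).verts,
        ((g.contract _ he).contract _ h1).edges,
        Function.update g.lab k ((g.lab i).mul ((g.lab k).mul (g.lab j))),
        ((g.contract _ he).contract _ h1).tree⟩ := by
    refine cls_smul k _ (by simp [Gen.contract, hki, hkj, hk]) rfl rfl ?_ ?_ ?_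
    · intro v hv hvk
      have hvi : v ≠ i := by simp [Gen.contract] at hv; exact hv.1
      simp [Gen.contract, hvi, hvk]
    · simp only [Gen.contract, Function.update_self, Function.update_of_ne hki, Hom.mul]
      ring
    · simp only [Gen.contract, Function.update_self, Function.update_of_ne hki, Hom.mul]
      rw [← W.mul_assoc, W.mul_comm (g.lab k).mem (g.lab i).mem, map_smul, LinearMap.smul_apply,
        W.mul_assoc, Hom.deg_cast, Hom.deg_cast, _root_.mul_comm (_ + 1)]
      rfl
  rw [muE2_eq he c1 c2 h1, muE2_eq he' c3 c4 h2, cls_perm hR, hC, smul_smul, smul_smul,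
    ← sgn_add, ← sgn_add]
  refine neg_of_sgn ?_
  have := sign_in (ε := g.ε) hi hj hk hij hki.symm hkj.symm
      (η := ((g.contract _ he').contract _ h2).ε) (fun v _ hvi hvk => by
        rw [contract_ε, contract_ε]; simp [hvi, hvk]) (by
        rw [contract_ε, contract_ε]; simp [hki.symm]; grind)
  refine Eq.trans ?_ this
  simp only [Gen.contract]; ring

lemma muE2_disj {g : W.Gen} {i j k l : ℕ} {T : Multiset (ℕ × ℕ)}
    (hE : g.edges = (i, j) ::ₘ (k, l) ::ₘ T) (hik : i ≠ k) (hil : i ≠ l) (hjk : j ≠ k)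
    (hjl : j ≠ l) : muE2 g (i, j) (k, l) + muE2 g (k, l) (i, j) = 0 := by
  have hE' : g.edges = (k, l) ::ₘ (i, j) ::ₘ T := by rw [hE, Multiset.cons_swap]
  have he : (i, j) ∈ g.edges := by rw [hE]; simp
  have he' : (k, l) ∈ g.edges := by rw [hE]; simp
  obtain ⟨hi, hj⟩ := g.tree.mem _ he
  obtain ⟨hk, hl⟩ := g.tree.mem _ he'
  have hij : i ≠ j := g.tree.ne he
  have hkl : k ≠ l := g.tree.ne he'
  simp only at hi hj hk hl
  have c1 : collapse i j k = k := collapse_ne hjk.symm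
  have c2 : collapse i j l = l := collapse_ne hjl.symm
  have c3 : collapse k l i = i := collapse_ne hil
  have c4 : collapse k l j = j := collapse_ne hjl
  have h1 : (k, l) ∈ (g.contract _ he).edges := by rw [contract_edges_eq hE he, c1, c2]; simp
  have h2 : (i, j) ∈ (g.contract _ he').edges := by rw [contract_edges_eq hE' he', c3, c4]; simp
  rw [muE2_eq he c1 c2 h1, muE2_eq he' c3 c4 h2,
    cls_congr (g := (g.contract _ he).contract _ h1) (g' := (g.contract _ he').contract _ h2)]
  · exact neg_of_sgn (sign_disj hi hj hk hl hij hik hil hjk hjl hkl)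
  · simp only [Gen.contract]; rw [Finset.erase_right_comm]
  · rw [contract_contract_edges hE he c1 c2 h1, contract_contract_edges hE' he' c3 c4 h2]
    have : collapse i j ∘ collapse k l = collapse k l ∘ collapse i j := by
      funext v; simp only [Function.comp, collapse]; split_ifs <;> simp_all
    rw [this]
  · intro v hv
    simp only [Gen.contract, Function.update_of_ne hik, Function.update_of_ne hjk,
      Function.update_of_ne hik.symm, Function.update_of_ne hil.symm]
    rw [Function.update_comm hik]

lemma muE2_anti {g : W.Gen} {e e' : ℕ × ℕ} (he : e ∈ g.edges) (he' : e' ∈ g.edges.erase e) :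
    muE2 g e e' + muE2 g e' e = 0 := by
  obtain ⟨i, j⟩ := e
  obtain ⟨k, l⟩ := e'
  have hE : g.edges = (i, j) ::ₘ (k, l) ::ₘ ((g.edges.erase (i, j)).erase (k, l)) := by
    rw [Multiset.cons_erase he', Multiset.cons_erase he]
  have hE' := hE
  rw [Multiset.cons_swap] at hE'
  by_cases hik : i = k
  · subst hik; exact muE2_out hE
  by_cases hjl : j = l
  · subst hjl; exact muE2_in hE
  by_cases hjk : j = k
  · subst hjk; exact muE2_path hE
  by_cases hil : i = l
  · subst hil; rw [add_comm]; exact muE2_path hE'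
  exact muE2_disj hE hik hil hjk hjl

lemma sum_anti {α M : Type*} [DecidableEq α] [AddCommGroup M] (h : α → α → M) (E : Multiset α)
    (hE : ∀ e ∈ E, ∀ e' ∈ E.erase e, h e e' + h e' e = 0) :
    (E.map fun e => ((E.erase e).map (h e)).sum).sum = 0 := by
  induction E using Multiset.induction_on with
  | empty => simp
  | cons a E ih =>
    rw [Multiset.map_cons, Multiset.sum_cons, Multiset.erase_cons_head]
    have : (E.map fun e => (((a ::ₘ E).erase e).map (h e)).sum) =
        E.map fun e => h e a + ((E.erase e).map (h e)).sum :=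
      Multiset.map_congr rfl fun e he => by
        rw [Multiset.erase_cons_tail_of_mem he, Multiset.map_cons, Multiset.sum_cons]
    rw [this, Multiset.sum_map_add, ih, add_zero, ← Multiset.sum_map_add]
    · refine Multiset.sum_eq_zero fun x hx => ?_
      obtain ⟨e, he, rfl⟩ := Multiset.mem_map.1 hx
      exact hE a (Multiset.mem_cons_self _ _) e (by rwa [Multiset.erase_cons_head])
    · intro e he e' he'
      refine hE e (Multiset.mem_cons_of_mem he) e' ?_
      rw [Multiset.erase_cons_tail_of_mem he]
      exact Multiset.mem_cons_of_mem he'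

lemma dMu_dMu (x : W.EE) : W.dMu (W.dMu x) = 0 := by
  suffices h : W.dMu ∘ₗ W.dMu = 0 from LinearMap.congr_fun h x
  refine Submodule.linearMap_qext _ (Finsupp.lhom_ext' fun g => LinearMap.ext_ring ?_)
  change W.dMu (W.dMu g.cls) = 0
  rw [dMu_cls, dMuGen, map_multiset_sum, Multiset.map_map]
  rw [← sum_anti (muE2 g) g.edges (fun e he e' he' => muE2_anti he he')]
  refine congrArg _ (Multiset.map_congr rfl fun e he => ?_)
  simp only [Function.comp]
  rw [muE_of_mem he, map_smul, dMu_cls, dMuGen, Multiset.smul_sum]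
  change (Multiset.map _ (Multiset.map _ (contractEdges g.edges e))).sum = _
  rw [contractEdges, Multiset.map_map, Multiset.map_map]
  refine congrArg _ (Multiset.map_congr rfl fun e' _ => ?_)
  simp only [Function.comp, muE2, dif_pos he]

end AugCDGA

/-! ### The spectral sequence of a filtered complex -/

/-- A differential `ℚ`-vector space with an increasing filtration. -/
structure FilteredComplex where
  carrier : Type u
  [acg : AddCommGroup carrier]
  [mod : Module ℚ carrier]
  D : carrier →ₗ[ℚ] carrier
  D_D : ∀ x, D (D x) = 0
  F : ℤ → Submodule ℚ carrier
  mono : Monotone F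
  D_mem : ∀ {p : ℤ} {x : carrier}, x ∈ F p → D x ∈ F p

attribute [instance] FilteredComplex.acg FilteredComplex.mod

namespace FilteredComplex

variable (C : FilteredComplex.{u})

/-- The approximate cycles `Z^r_p = {x ∈ F_p : D x ∈ F_{p-r}}`. -/
def Z (r p : ℤ) : Submodule ℚ C.carrier := C.F p ⊓ (C.F (p - r)).comap C.D

/-- The approximate boundaries `Z^{r-1}_{p-1} + D Z^{r-1}_{p+r-1}`. -/
def B (r p : ℤ) : Submodule ℚ C.carrier :=
  C.Z (r - 1) (p - 1) ⊔ (C.Z (r - 1) (p + r - 1)).map C.D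

/-- The column `p` of the page `E_r` of the spectral sequence (the sum over all inner degrees):
`E_r^p = Z^r_p / (Z^{r-1}_{p-1} + D Z^{r-1}_{p+r-1})`. -/
abbrev E (r p : ℤ) : Type u := C.Z r p ⧸ (C.B r p).submoduleOf (C.Z r p)

variable {C}

lemma D_mem_Z {r p : ℤ} {x : C.carrier} (hx : x ∈ C.Z r p) : C.D x ∈ C.Z r (p - r) :=
  ⟨hx.2, by change C.D (C.D x) ∈ C.F _; rw [C.D_D]; exact zero_mem _⟩

variable (C)

/-- The differential `d_r : E_r^p → E_r^{p-r}`, `[x] ↦ [D x]`. -/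
def d (r p : ℤ) : C.E r p →ₗ[ℚ] C.E r (p - r) :=
  Submodule.mapQ _ _ (C.D.restrict fun _ hx => D_mem_Z hx) (by
    rintro ⟨x, hx⟩ hxB
    obtain ⟨y, hy, z, hz, hyz⟩ := Submodule.mem_sup.1 (Submodule.mem_comap.1 hxB)
    obtain ⟨w, -, rfl⟩ := hz
    refine Submodule.mem_sup_right ⟨y, ?_, ?_⟩
    · rw [show p - r + r - 1 = p - 1 by ring]; exact hy
    · change C.D y = C.D x
      change y + C.D w = x at hyz
      rw [← hyz, map_add, C.D_D, add_zero])

variable {C}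

/-- The element `x` of `F_p` survives to the page `E_r` and represents there the class `ξ`: up to
terms of lower filtration it is an element `z` of `Z^r_p` with class `ξ`. -/
def Represents (r p : ℤ) (x : C.carrier) (ξ : C.E r p) : Prop :=
  ∃ z : C.Z r p, x - z ∈ C.F (p - 1) ∧ Submodule.Quotient.mk z = ξ

/-- An element represents at most one class. -/
lemma Represents.unique {r p : ℤ} {x : C.carrier} {ξ ξ' : C.E r p}
    (h : Represents r p x ξ) (h' : Represents r p x ξ') : ξ = ξ' := by
  obtain ⟨z, hz, rfl⟩ := h
  obtain ⟨z', hz', rfl⟩ := h'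
  refine (Submodule.Quotient.eq _).2 (Submodule.mem_sup_left ⟨?_, ?_⟩)
  · change (z : C.carrier) - z' ∈ _
    have := sub_mem hz' hz
    rwa [sub_sub_sub_cancel_left] at this
  · have := (z - z').2.2
    rwa [show p - r = p - 1 - (r - 1) by ring] at this

end FilteredComplex

namespace AugCDGA

variable (W : AugCDGA.{u})

/-- The filtration by columns: `F_p` is spanned by the trees with at most `p` edges. -/
noncomputable def colFilt (p : ℤ) : Submodule ℚ W.EE :=
  Submodule.span ℚ {x | ∃ g : W.Gen, (g.edges.card : ℤ) ≤ p ∧ g.cls = x}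

/-- The Sinha-Walter complex of `W`: the total complex of the bicomplex `(𝔼(s⁻¹ W̄), d_W, d_μ)`,
filtered by columns. -/
noncomputable def sinhaWalter : FilteredComplex.{u} where
  carrier := W.EE
  D := W.dW + W.dMu
  D_D := fun x => by
    simp only [LinearMap.add_apply, map_add]
    rw [dW_dW, dMu_dMu, zero_add, add_zero, dW_dMu]
  F := W.colFilt
  mono := fun p q hpq => Submodule.span_mono (by
    rintro x ⟨g, hg, rfl⟩; exact ⟨g, hg.trans hpq, rfl⟩)
  D_mem := by
    intro p x hx
    induction hx using Submodule.span_induction with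
    | zero => rw [map_zero]; exact zero_mem _
    | add x y _ _ hx hy => rw [map_add]; exact add_mem hx hy
    | smul a x _ hx => rw [map_smul]; exact Submodule.smul_mem _ _ hx
    | mem x hx =>
      obtain ⟨g, hg, rfl⟩ := hx
      rw [LinearMap.add_apply, dW_cls, dMu_cls]
      refine add_mem (Submodule.sum_mem _ fun x _ => Submodule.smul_mem _ _
        (Submodule.subset_span ⟨g.diff x, hg, rfl⟩)) (multiset_sum_mem _ fun y hy => ?_)
      obtain ⟨e, he, rfl⟩ := Multiset.mem_map.1 hy
      rw [muE_of_mem he]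
      refine Submodule.smul_mem _ _ (Submodule.subset_span ⟨_, ?_, rfl⟩)
      have := card_contractEdges he
      simp only [Gen.contract]
      omega

variable {W}

/-- The edges `0 → 1 → ⋯ → n` of the long graph. -/
def longEdges (n : ℕ) : Multiset (ℕ × ℕ) := (Multiset.range n).map fun v => (v, v + 1)

lemma isDirTree_long (n : ℕ) : IsDirTree (Finset.range (n + 1)) (longEdges n) where
  mem := by
    intro e he
    obtain ⟨v, hv, rfl⟩ := Multiset.mem_map.1 he
    rw [Multiset.mem_range] at hv
    simp only [Finset.mem_range]
    omega
  conn := by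
    have key : ∀ v, v < n + 1 → Relation.EqvGen (fun x y => (x, y) ∈ longEdges n) 0 v := by
      intro v
      induction v with
      | zero => exact fun _ => Relation.EqvGen.refl _
      | succ v ih =>
        intro hv
        refine Relation.EqvGen.trans _ _ _ (ih (by omega)) (Relation.EqvGen.rel _ _ ?_)
        exact Multiset.mem_map.2 ⟨v, by rw [Multiset.mem_range]; omega, rfl⟩
    intro u hu v hv
    rw [Finset.mem_range] at hu hv
    exact Relation.EqvGen.trans _ _ _ (Relation.EqvGen.symm _ _ (key u hu)) (key v hv)
  card := by simp [longEdges]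

/-- The element `a₀|a₁|⋯|aₙ` given by the long graph `0 → 1 → ⋯ → n`. -/
noncomputable def bar {n : ℕ} (a : Fin (n + 1) → W.Hom) : W.sinhaWalter.carrier :=
  Gen.cls (W := W) ⟨Finset.range (n + 1), longEdges n, fun v => a (Fin.ofNat (n + 1) v),
    isDirTree_long n⟩

end AugCDGA

/-! ### The relative atomic complex of a subspace arrangement -/

section RelativeAtomicComplex

set_option linter.unusedSectionVars false

variable {V : Type*} [AddCommGroup V] [Module ℂ V]

/-- The codimension of a subspace. -/
noncomputable def codim (A : Submodule ℂ V) : ℕ := Module.finrank ℂ (V ⧸ A)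

section

variable [FiniteDimensional ℂ V]

lemma codim_add (A : Submodule ℂ V) : codim A + Module.finrank ℂ A = Module.finrank ℂ V :=
  Submodule.finrank_quotient_add_finrank A

lemma codim_mono {A B : Submodule ℂ V} (h : A ≤ B) : codim B ≤ codim A := by
  have := codim_add A
  have := codim_add B
  have := Submodule.finrank_mono h
  omega

lemma eq_of_codim {A B : Submodule ℂ V} (h : A ≤ B) (h' : codim A = codim B) : A = B := by
  have := codim_add A
  have := codim_add B
  exact Submodule.eq_of_le_of_finrank_eq h (by omega)

lemma codim_inf (A B : Submodule ℂ V) : codim (A ⊓ B) + codim (A ⊔ B) = codim A + codim B := by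
  have := codim_add A
  have := codim_add B
  have := codim_add (A ⊓ B)
  have := codim_add (A ⊔ B)
  have := Submodule.finrank_sup_add_finrank_inf_eq A B
  omega

lemma codim_top : codim (⊤ : Submodule ℂ V) = 0 := by
  have := codim_add (⊤ : Submodule ℂ V)
  rw [finrank_top] at this
  omega

end

variable {Λ : Type u} [LinearOrder Λ] (X : Λ → Submodule ℂ V)

/-- The join `⋁ σ` in the intersection lattice, that is, `⋂_{i ∈ σ} X i`. -/
def join (σ : Finset Λ) : Submodule ℂ V := σ.inf X

/-- The parity of the permutation which sorts the sequence formed by the elements of `σ` in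
increasing order followed by those of `τ` in increasing order. -/
def shufflePar (σ τ : Finset Λ) : ZMod 2 := ∑ s ∈ σ, ∑ t ∈ τ, if t < s then 1 else 0

/-- The parity of the position of `i` in `σ`; the smallest element has position `1`. -/
def posPar (σ : Finset Λ) (i : Λ) : ZMod 2 := ∑ s ∈ σ, if s ≤ i then 1 else 0

/-- The degree of the generator `a_σ`. -/
noncomputable def atomicDeg (σ : Finset Λ) : ℤ := 2 * codim (join X σ) - σ.card

open Classical in
/-- The product `a_σ a_τ`. -/
noncomputable def mulGen (σ τ : Finset Λ) : Finset Λ →₀ ℚ :=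
  if codim (join X σ) + codim (join X τ) = codim (join X (σ ∪ τ)) then
    sgn (shufflePar σ τ) • Finsupp.single (σ ∪ τ) 1 else 0

open Classical in
/-- The differential `d a_σ`. -/
noncomputable def diffGen (σ : Finset Λ) : Finset Λ →₀ ℚ :=
  ∑ i ∈ σ, if join X (σ.erase i) = join X σ then
    sgn (posPar σ i) • Finsupp.single (σ.erase i) 1 else 0

/-- The product of `D_𝒜`, extended bilinearly. -/
noncomputable def atomicMul :
    (Finset Λ →₀ ℚ) →ₗ[ℚ] (Finset Λ →₀ ℚ) →ₗ[ℚ] (Finset Λ →₀ ℚ) :=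
  Finsupp.linearCombination ℚ fun σ => Finsupp.linearCombination ℚ fun τ => mulGen X σ τ

/-- The differential of `D_𝒜`, extended linearly. -/
noncomputable def atomicD : (Finset Λ →₀ ℚ) →ₗ[ℚ] (Finset Λ →₀ ℚ) :=
  Finsupp.linearCombination ℚ (diffGen X)

lemma atomicMul_single (σ τ : Finset Λ) :
    atomicMul X (Finsupp.single σ 1) (Finsupp.single τ 1) = mulGen X σ τ := by
  simp [atomicMul]

lemma atomicD_single (σ : Finset Λ) : atomicD X (Finsupp.single σ 1) = diffGen X σ := by
  simp [atomicD]

lemma join_union (σ τ : Finset Λ) : join X (σ ∪ τ) = join X σ ⊓ join X τ := Finset.inf_union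

lemma join_anti {σ τ : Finset Λ} (h : σ ⊆ τ) : join X τ ≤ join X σ := Finset.inf_mono h

variable [FiniteDimensional ℂ V] {X}

lemma codim_join_union_le (σ τ : Finset Λ) :
    codim (join X (σ ∪ τ)) ≤ codim (join X σ) + codim (join X τ) := by
  rw [join_union]
  have := codim_inf (join X σ) (join X τ)
  omega

lemma disjoint_of_mult (hX : ∀ i, X i ≠ ⊤) {σ τ : Finset Λ}
    (h : codim (join X σ) + codim (join X τ) = codim (join X (σ ∪ τ))) : Disjoint σ τ := by
  rw [Finset.disjoint_left]
  intro i hi hi'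
  rw [join_union] at h
  have h1 := codim_inf (join X σ) (join X τ)
  have h2 : join X σ ⊔ join X τ ≤ X i := sup_le (Finset.inf_le hi) (Finset.inf_le hi')
  have h3 : join X σ ⊔ join X τ = ⊤ := eq_of_codim le_top (by rw [codim_top]; omega)
  exact hX i (top_le_iff.1 (h3 ▸ h2))

lemma shufflePar_comm {σ τ : Finset Λ} (h : Disjoint σ τ) :
    shufflePar σ τ = (σ.card : ZMod 2) * τ.card + shufflePar τ σ := by
  unfold shufflePar
  rw [Finset.sum_comm (s := τ)]
  have : ((σ.card : ZMod 2) * τ.card) = ∑ s ∈ σ, ∑ t ∈ τ, 1 := by simp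
  rw [this, ← Finset.sum_add_distrib]
  refine Finset.sum_congr rfl fun s hs => ?_
  rw [← Finset.sum_add_distrib]
  refine Finset.sum_congr rfl fun t ht => ?_
  have hst : s ≠ t := fun e => Finset.disjoint_left.1 h hs (e ▸ ht)
  rcases lt_or_gt_of_ne hst with h | h
  · simp [h, h.not_gt]; decide
  · simp [h, h.not_gt]

lemma shufflePar_union_left {σ τ ρ : Finset Λ} (h : Disjoint σ τ) :
    shufflePar (σ ∪ τ) ρ = shufflePar σ ρ + shufflePar τ ρ := Finset.sum_union h

lemma shufflePar_union_right {σ τ ρ : Finset Λ} (h : Disjoint τ ρ) :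
    shufflePar σ (τ ∪ ρ) = shufflePar σ τ + shufflePar σ ρ := by
  unfold shufflePar
  rw [← Finset.sum_add_distrib]
  exact Finset.sum_congr rfl fun s _ => Finset.sum_union h

lemma posPar_union {σ τ : Finset Λ} (h : Disjoint σ τ) (i : Λ) :
    posPar (σ ∪ τ) i = posPar σ i + posPar τ i := Finset.sum_union h

lemma shufflePar_left {σ τ : Finset Λ} (h : Disjoint σ τ) {i : Λ} (hi : i ∈ σ) :
    shufflePar σ τ + posPar (σ ∪ τ) i = posPar σ i + shufflePar (σ.erase i) τ := by
  rw [posPar_union h]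
  have h1 : shufflePar σ τ = posPar τ i + shufflePar (σ.erase i) τ := by
    unfold shufflePar posPar
    rw [← Finset.add_sum_erase σ _ hi]
    congr 1
    refine Finset.sum_congr rfl fun t ht => ?_
    have hst : t ≠ i := fun e => Finset.disjoint_left.1 h hi (e ▸ ht)
    simp [le_iff_lt_or_eq, hst]
  rw [h1]; grind

lemma shufflePar_right {σ τ : Finset Λ} (h : Disjoint σ τ) {i : Λ} (hi : i ∈ τ) :
    shufflePar σ τ + posPar (σ ∪ τ) i = (σ.card : ZMod 2) + posPar τ i +
      shufflePar σ (τ.erase i) := by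
  rw [posPar_union h]
  have h1 : shufflePar σ τ + posPar σ i = (σ.card : ZMod 2) + shufflePar σ (τ.erase i) := by
    have : (σ.card : ZMod 2) = ∑ s ∈ σ, 1 := by simp
    unfold shufflePar posPar
    rw [this, ← Finset.sum_add_distrib, ← Finset.sum_add_distrib]
    refine Finset.sum_congr rfl fun s _ => ?_
    rw [← Finset.add_sum_erase τ _ hi]
    rcases lt_or_ge i s with h | h
    · simp [h, h.not_ge]
    · simp [h, h.not_gt]; ring
  grind

lemma mult_erase_left {σ τ : Finset Λ} {i : Λ} (h : join X (σ.erase i) = join X σ) :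
    (codim (join X (σ.erase i)) + codim (join X τ) = codim (join X (σ.erase i ∪ τ))) ↔
    (codim (join X σ) + codim (join X τ) = codim (join X (σ ∪ τ))) := by
  rw [join_union, join_union, h]

lemma mult_erase_right {σ τ : Finset Λ} {i : Λ} (h : join X (τ.erase i) = join X τ) :
    (codim (join X σ) + codim (join X (τ.erase i)) = codim (join X (σ ∪ τ.erase i))) ↔
    (codim (join X σ) + codim (join X τ) = codim (join X (σ ∪ τ))) := by
  rw [join_union, join_union, h]

lemma join_erase_iff {σ τ : Finset Λ} {i : Λ}
    (h : codim (join X σ) + codim (join X τ) = codim (join X (σ ∪ τ))) :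
    join X (σ.erase i ∪ τ) = join X (σ ∪ τ) ↔ join X (σ.erase i) = join X σ := by
  constructor
  · intro h1
    have h2 := codim_join_union_le (X := X) (σ.erase i) τ
    have h3 : join X σ ≤ join X (σ.erase i) := join_anti X (Finset.erase_subset _ _)
    have h4 := codim_mono h3
    rw [h1] at h2
    exact (eq_of_codim h3 (by omega)).symm
  · intro h1
    rw [join_union, join_union, h1]

lemma mulGen_comm (hX : ∀ i, X i ≠ ⊤) (σ τ : Finset Λ) :
    mulGen X σ τ = sgn ((σ.card : ZMod 2) * τ.card) • mulGen X τ σ := by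
  unfold mulGen
  rw [Finset.union_comm τ σ, add_comm (codim (join X τ))]
  split_ifs with h
  · rw [smul_smul, ← sgn_add, shufflePar_comm (disjoint_of_mult hX h)]
  · simp

lemma mulGen_assoc (hX : ∀ i, X i ≠ ⊤) (σ τ ρ : Finset Λ) :
    atomicMul X (mulGen X σ τ) (Finsupp.single ρ 1) =
      atomicMul X (Finsupp.single σ 1) (mulGen X τ ρ) := by
  have h1 := codim_join_union_le (X := X) σ τ
  have h2 := codim_join_union_le (X := X) (σ ∪ τ) ρ
  have h3 := codim_join_union_le (X := X) τ ρ
  have h4 := codim_join_union_le (X := X) σ (τ ∪ ρ)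
  have h5 : σ ∪ τ ∪ ρ = σ ∪ (τ ∪ ρ) := Finset.union_assoc _ _ _
  by_cases hm : codim (join X σ) + codim (join X τ) + codim (join X ρ) =
      codim (join X (σ ∪ (τ ∪ ρ)))
  · rw [h5] at h2
    have m1 : codim (join X σ) + codim (join X τ) = codim (join X (σ ∪ τ)) := by omega
    have m2 : codim (join X (σ ∪ τ)) + codim (join X ρ) = codim (join X (σ ∪ τ ∪ ρ)) := by
      rw [h5]; omega
    have m3 : codim (join X τ) + codim (join X ρ) = codim (join X (τ ∪ ρ)) := by omega
    have m4 : codim (join X σ) + codim (join X (τ ∪ ρ)) = codim (join X (σ ∪ (τ ∪ ρ))) := by omega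
    have e1 : mulGen X σ τ = sgn (shufflePar σ τ) • Finsupp.single (σ ∪ τ) 1 := if_pos m1
    have e2 : mulGen X τ ρ = sgn (shufflePar τ ρ) • Finsupp.single (τ ∪ ρ) 1 := if_pos m3
    have e3 : mulGen X (σ ∪ τ) ρ = sgn (shufflePar (σ ∪ τ) ρ) • Finsupp.single (σ ∪ τ ∪ ρ) 1 :=
      if_pos m2
    have e4 : mulGen X σ (τ ∪ ρ) = sgn (shufflePar σ (τ ∪ ρ)) •
      Finsupp.single (σ ∪ (τ ∪ ρ)) 1 := if_pos m4
    rw [e1, e2, map_smul, map_smul, LinearMap.smul_apply, atomicMul_single, atomicMul_single,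
      e3, e4, h5, smul_smul, smul_smul, ← sgn_add, ← sgn_add,
      shufflePar_union_left (disjoint_of_mult hX m1),
      shufflePar_union_right (disjoint_of_mult hX m3)]
    congr 2; ring
  · have e1 : atomicMul X (mulGen X σ τ) (Finsupp.single ρ 1) = 0 := by
      unfold mulGen
      split_ifs with h
      · rw [map_smul, LinearMap.smul_apply, atomicMul_single, mulGen, if_neg, smul_zero]
        rw [h5]; omega
      · simp
    have e2 : atomicMul X (Finsupp.single σ 1) (mulGen X τ ρ) = 0 := by
      unfold mulGen
      split_ifs with h
      · rw [map_smul, atomicMul_single, mulGen, if_neg, smul_zero]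
        omega
      · simp
    rw [e1, e2]

lemma atomicD_mulGen (hX : ∀ i, X i ≠ ⊤) (σ τ : Finset Λ) :
    atomicD X (mulGen X σ τ) = atomicMul X (diffGen X σ) (Finsupp.single τ 1) +
      sgn (σ.card : ZMod 2) • atomicMul X (Finsupp.single σ 1) (diffGen X τ) := by
  have e1 : atomicMul X (diffGen X σ) (Finsupp.single τ 1) =
      ∑ i ∈ σ, (open Classical in if join X (σ.erase i) = join X σ then
        sgn (posPar σ i) • mulGen X (σ.erase i) τ else 0) := by
    rw [diffGen, map_sum, LinearMap.sum_apply]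
    refine Finset.sum_congr rfl fun i _ => ?_
    split_ifs
    · rw [map_smul, LinearMap.smul_apply, atomicMul_single]
    · simp
  have e2 : atomicMul X (Finsupp.single σ 1) (diffGen X τ) =
      ∑ i ∈ τ, (open Classical in if join X (τ.erase i) = join X τ then
        sgn (posPar τ i) • mulGen X σ (τ.erase i) else 0) := by
    rw [diffGen, map_sum]
    refine Finset.sum_congr rfl fun i _ => ?_
    split_ifs
    · rw [map_smul, atomicMul_single]
    · simp
  rw [e1, e2]
  by_cases h : codim (join X σ) + codim (join X τ) = codim (join X (σ ∪ τ))
  · have hd := disjoint_of_mult hX h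
    have h' : codim (join X τ) + codim (join X σ) = codim (join X (τ ∪ σ)) := by
      rw [Finset.union_comm, add_comm]; exact h
    rw [mulGen, if_pos h, map_smul, atomicD_single, diffGen, Finset.sum_union hd, smul_add,
      Finset.smul_sum, Finset.smul_sum, Finset.smul_sum]
    congr 1
    · refine Finset.sum_congr rfl fun i hi => ?_
      have hi' : i ∉ τ := Finset.disjoint_left.1 hd hi
      have he : (σ ∪ τ).erase i = σ.erase i ∪ τ := by
        rw [Finset.erase_union_distrib, Finset.erase_eq_of_notMem hi']
      rw [he]
      by_cases hc : join X (σ.erase i) = join X σ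
      · rw [if_pos ((join_erase_iff h).2 hc), if_pos hc, mulGen, if_pos ((mult_erase_left hc).2 h),
          smul_smul, smul_smul, ← sgn_add, ← sgn_add, shufflePar_left hd hi]
      · rw [if_neg (fun hh => hc ((join_erase_iff h).1 hh)), if_neg hc, smul_zero]
    · refine Finset.sum_congr rfl fun i hi => ?_
      have hi' : i ∉ σ := Finset.disjoint_right.1 hd hi
      have he : (σ ∪ τ).erase i = σ ∪ τ.erase i := by
        rw [Finset.erase_union_distrib, Finset.erase_eq_of_notMem hi']
      rw [he]
      by_cases hc : join X (τ.erase i) = join X τ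
      · have hc' : join X (σ ∪ τ.erase i) = join X (σ ∪ τ) := by
          rw [join_union, join_union, hc]
        rw [if_pos hc', if_pos hc, mulGen, if_pos ((mult_erase_right hc).2 h),
          smul_smul, smul_smul, smul_smul, ← sgn_add, ← sgn_add, ← sgn_add, shufflePar_right hd hi,
          add_assoc]
      · rw [if_neg, if_neg hc, smul_zero, smul_zero]
        intro hh
        rw [Finset.union_comm, Finset.union_comm σ τ] at hh
        exact hc ((join_erase_iff h').1 hh)
  · rw [mulGen, if_neg h, map_zero, Finset.sum_eq_zero, Finset.sum_eq_zero, smul_zero, add_zero]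
    · intro i _
      split_ifs with hc
      · rw [mulGen, if_neg (fun hh => h ((mult_erase_right hc).1 hh)), smul_zero]
      · rfl
    · intro i _
      split_ifs with hc
      · rw [mulGen, if_neg (fun hh => h ((mult_erase_left hc).1 hh)), smul_zero]
      · rfl

open Classical in
lemma atomicD_diffGen (σ : Finset Λ) : atomicD X (diffGen X σ) = 0 := by
  rw [diffGen, map_sum]
  let h : Λ → Λ → (Finset Λ →₀ ℚ) := fun i j =>
    if join X ((σ.erase i).erase j) = join X σ then
      sgn (posPar σ i + posPar (σ.erase i) j) • Finsupp.single ((σ.erase i).erase j) 1 else 0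
  have key := AugCDGA.sum_anti h σ.val (by
    intro i hi j hj
    rw [← Finset.erase_val] at hj
    have hj' : j ∈ σ.erase i := hj
    rw [Finset.mem_erase] at hj'
    have hi' : i ∈ σ := hi
    simp only [h, Finset.erase_right_comm (a := j)]
    split_ifs with hc
    · rw [← add_smul]
      have : posPar σ j + posPar (σ.erase j) i = (posPar σ i + posPar (σ.erase i) j) + 1 := by
        have e1 : posPar σ j = (if i ≤ j then 1 else 0) + posPar (σ.erase i) j :=
          (Finset.add_sum_erase σ _ hi').symm
        have e2 : posPar σ i = (if j ≤ i then 1 else 0) + posPar (σ.erase j) i :=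
          (Finset.add_sum_erase σ _ hj'.2).symm
        rw [e1, e2]
        rcases lt_or_gt_of_ne hj'.1 with hlt | hlt
        · simp [hlt.le, hlt.not_ge]; grind
        · simp [hlt.le, hlt.not_ge]; grind
      rw [this, sgn_add _ 1, sgn_one]; simp
    · simp)
  refine Eq.trans ?_ key
  change _ = ∑ i ∈ σ, _
  refine Finset.sum_congr rfl fun i hi => ?_
  rw [← Finset.erase_val]
  change _ = ∑ j ∈ σ.erase i, h i j
  have hle1 : join X σ ≤ join X (σ.erase i) := join_anti X (Finset.erase_subset _ _)
  split_ifs with hc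
  · rw [map_smul, atomicD_single, diffGen, Finset.smul_sum]
    refine Finset.sum_congr rfl fun j _ => ?_
    simp only [h]
    rw [hc]
    split_ifs
    · rw [smul_smul, sgn_add]
    · simp
  · rw [map_zero, Finset.sum_eq_zero]
    intro j _
    simp only [h]
    rw [if_neg]
    intro hh
    refine hc (le_antisymm ?_ hle1)
    rw [← hh]
    exact join_anti X (Finset.erase_subset _ _)

variable (X)

/-- The homogeneous parts of `D_𝒜`. -/
def atomicGr (i : ℤ) : Submodule ℚ (Finset Λ →₀ ℚ) :=
  Finsupp.supported ℚ ℚ {σ | atomicDeg X σ = i}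

variable {X}

lemma atomic_internal (_hX : ∀ i, X i ≠ ⊤) : DirectSum.IsInternal (atomicGr X) := by
  classical
  unfold atomicGr
  rw [DirectSum.isInternal_submodule_iff_iSupIndep_and_iSup_eq_top]
  constructor
  · rw [iSupIndep_def]
    intro i
    have hU : (⨆ j, ⨆ (_ : j ≠ i), Finsupp.supported ℚ ℚ {σ : Finset Λ | atomicDeg X σ = j}) =
        Finsupp.supported ℚ ℚ (⋃ j, ⋃ (_ : j ≠ i), {σ : Finset Λ | atomicDeg X σ = j}) := by
      rw [Finsupp.supported_iUnion]
      refine iSup_congr fun j => ?_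
      by_cases h : j = i <;> simp [h]
    rw [hU, Finsupp.disjoint_supported_supported_iff]
    rw [Set.disjoint_left]
    intro σ h1 h2
    simp only [Set.mem_iUnion, Set.mem_ofPred_eq] at h1 h2
    obtain ⟨j, hj, h3⟩ := h2
    exact hj (h3.symm.trans h1)
  · rw [← Finsupp.supported_iUnion, ← Finsupp.supported_univ]
    congr 1
    ext σ; simp

lemma atomic_mul_mem (hX : ∀ i, X i ≠ ⊤) : ∀ {i j : ℤ} {x y : Finset Λ →₀ ℚ},
    x ∈ atomicGr X i → y ∈ atomicGr X j →
    atomicMul X x y ∈ atomicGr X (i + j) := by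
  intro i j x y hx hy
  rw [atomicGr, Finsupp.supported_eq_span_single] at hx hy
  induction hx using Submodule.span_induction with
  | zero => simp
  | add x x' _ _ h1 h2 => rw [map_add]; exact add_mem h1 h2
  | smul a x _ h => rw [map_smul]; exact Submodule.smul_mem _ _ h
  | mem x hx =>
    obtain ⟨σ, hσ, rfl⟩ := hx
    induction hy using Submodule.span_induction with
    | zero => simp
    | add x x' _ _ h1 h2 => rw [map_add]; exact add_mem h1 h2
    | smul a x _ h => rw [map_smul]; exact Submodule.smul_mem _ _ h
    | mem y hy =>
      obtain ⟨τ, hτ, rfl⟩ := hy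
      simp only [atomicMul_single]
      unfold mulGen
      split_ifs with h
      · refine Submodule.smul_mem _ _ (Finsupp.single_mem_supported _ _ ?_)
        have hc := Finset.card_union_of_disjoint (disjoint_of_mult hX h)
        simp only [Set.mem_ofPred_eq, atomicDeg] at hσ hτ ⊢
        rw [← h, hc]; push_cast; omega
      · exact zero_mem _

lemma atomic_d_mem (_hX : ∀ i, X i ≠ ⊤) : ∀ {i : ℤ} {x : Finset Λ →₀ ℚ}, x ∈ atomicGr X i →
    atomicD X x ∈ atomicGr X (i + 1) := by
  intro i x hx
  rw [atomicGr, Finsupp.supported_eq_span_single] at hx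
  induction hx using Submodule.span_induction with
  | zero => simp
  | add x x' _ _ h1 h2 => rw [map_add]; exact add_mem h1 h2
  | smul a x _ h => rw [map_smul]; exact Submodule.smul_mem _ _ h
  | mem x hx =>
    obtain ⟨σ, hσ, rfl⟩ := hx
    simp only [atomicD_single]
    unfold diffGen
    refine Submodule.sum_mem _ fun j hj => ?_
    split_ifs with h
    · refine Submodule.smul_mem _ _ (Finsupp.single_mem_supported _ _ ?_)
      have hc := Finset.card_erase_add_one hj
      simp only [Set.mem_ofPred_eq, atomicDeg] at hσ ⊢
      rw [h]; omega
    · exact zero_mem _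

lemma atomic_one_mul (_hX : ∀ i, X i ≠ ⊤) : ∀ x : Finset Λ →₀ ℚ,
    atomicMul X (Finsupp.single ∅ 1) x = x := by
  intro x
  induction x using Finsupp.induction_linear with
  | zero => simp
  | add x y hx hy => rw [map_add, hx, hy]
  | single τ a =>
    rw [← Finsupp.smul_single_one τ, map_smul, atomicMul_single, mulGen, if_pos]
    · simp [shufflePar, sgn_zero]
    · simp [join, codim_top]

lemma atomic_mul_assoc (hX : ∀ i, X i ≠ ⊤) : ∀ x y z : Finset Λ →₀ ℚ,
    atomicMul X (atomicMul X x y) z = atomicMul X x (atomicMul X y z) := by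
  intro x y z
  induction x using Finsupp.induction_linear with
  | zero => simp
  | add x y hx hy => simp only [map_add, LinearMap.add_apply, hx, hy]
  | single σ a =>
  induction y using Finsupp.induction_linear with
  | zero => simp
  | add x y hx hy => simp only [map_add, LinearMap.add_apply, hx, hy]
  | single τ b =>
  induction z using Finsupp.induction_linear with
  | zero => simp
  | add x y hx hy => simp only [map_add, hx, hy]
  | single ρ c =>
    rw [← Finsupp.smul_single_one σ, ← Finsupp.smul_single_one τ, ← Finsupp.smul_single_one ρ]
    simp only [map_smul, LinearMap.smul_apply, atomicMul_single, mulGen_assoc hX]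

lemma atomic_mul_comm (hX : ∀ i, X i ≠ ⊤) : ∀ {i j : ℤ} {x y : Finset Λ →₀ ℚ},
    x ∈ atomicGr X i → y ∈ atomicGr X j →
    atomicMul X x y = sgn ((i : ZMod 2) * (j : ZMod 2)) • atomicMul X y x := by
  intro i j x y hx hy
  rw [atomicGr, Finsupp.supported_eq_span_single] at hx hy
  induction hx using Submodule.span_induction with
  | zero => simp
  | add x x' _ _ h1 h2 => simp only [map_add, LinearMap.add_apply, h1, h2, smul_add]
  | smul a x _ h => rw [map_smul, map_smul, LinearMap.smul_apply, h, smul_comm]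
  | mem x hx =>
    obtain ⟨σ, hσ, rfl⟩ := hx
    induction hy using Submodule.span_induction with
    | zero => simp
    | add x x' _ _ h1 h2 => simp only [map_add, LinearMap.add_apply, h1, h2, smul_add]
    | smul a x _ h => rw [map_smul, map_smul, LinearMap.smul_apply, h, smul_comm]
    | mem y hy =>
      obtain ⟨τ, hτ, rfl⟩ := hy
      simp only [atomicMul_single]
      rw [mulGen_comm hX]
      simp only [Set.mem_ofPred_eq, atomicDeg] at hσ hτ
      rw [← hσ, ← hτ]
      push_cast
      rw [zmod2_two]
      congr 2; ring

lemma atomic_d_mul (hX : ∀ i, X i ≠ ⊤) : ∀ {i : ℤ} {x : Finset Λ →₀ ℚ} (y : Finset Λ →₀ ℚ),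
    x ∈ atomicGr X i →
    atomicD X (atomicMul X x y) =
      atomicMul X (atomicD X x) y + sgn (i : ZMod 2) • atomicMul X x (atomicD X y) := by
  intro i x y hx
  rw [atomicGr, Finsupp.supported_eq_span_single] at hx
  induction hx using Submodule.span_induction with
  | zero => simp
  | add x x' _ _ h1 h2 =>
    simp only [map_add, LinearMap.add_apply, h1, h2, smul_add]; abel
  | smul a x _ h =>
    simp only [map_smul, LinearMap.smul_apply, h, smul_add]
    rw [smul_comm a]
  | mem x hx =>
    obtain ⟨σ, hσ, rfl⟩ := hx
    have hp : ((i : ℤ) : ZMod 2) = (σ.card : ZMod 2) := by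
      simp only [Set.mem_ofPred_eq, atomicDeg] at hσ
      rw [← hσ]; push_cast; rw [zmod2_two]; grind
    rw [hp]
    induction y using Finsupp.induction_linear with
    | zero => simp
    | add x y hx hy => simp only [map_add, hx, hy, smul_add]; abel
    | single τ b =>
      rw [← Finsupp.smul_single_one τ]
      simp only [map_smul, atomicMul_single, atomicD_single, atomicD_mulGen hX, smul_add]
      rw [smul_comm b]

lemma atomic_d_d (_hX : ∀ i, X i ≠ ⊤) : ∀ x : Finset Λ →₀ ℚ, atomicD X (atomicD X x) = 0 := by
  intro x
  induction x using Finsupp.induction_linear with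
  | zero => simp
  | add x y hx hy => simp only [map_add, hx, hy, add_zero]
  | single σ a =>
    rw [← Finsupp.smul_single_one, map_smul, map_smul, atomicD_single, atomicD_diffGen, smul_zero]

lemma atomic_aug_mul (_hX : ∀ i, X i ≠ ⊤) : ∀ x y : Finset Λ →₀ ℚ,
    Finsupp.lapply (R := ℚ) ∅ (atomicMul X x y) =
      Finsupp.lapply (R := ℚ) (M := ℚ) ∅ x * Finsupp.lapply (R := ℚ) (M := ℚ) ∅ y := by
  intro x y
  induction x using Finsupp.induction_linear with
  | zero => simp
  | add x y hx hy => simp only [map_add, LinearMap.add_apply, hx, hy, add_mul]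
  | single σ a =>
  induction y using Finsupp.induction_linear with
  | zero => simp
  | add x y hx hy => simp only [map_add, hx, hy, mul_add]
  | single τ b =>
    rw [← Finsupp.smul_single_one σ, ← Finsupp.smul_single_one τ]
    simp only [map_smul, LinearMap.smul_apply, atomicMul_single]
    by_cases hs : σ = ∅
    · by_cases ht : τ = ∅
      · subst hs ht
        simp [mulGen, join, codim_top, shufflePar, sgn_zero, _root_.mul_comm]
      · simp only [mulGen]
        split_ifs <;> simp [hs, ht]
    · simp only [mulGen]
      split_ifs <;> simp [hs]

lemma atomic_aug_d (hX : ∀ i, X i ≠ ⊤) : ∀ x : Finset Λ →₀ ℚ,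
    Finsupp.lapply (R := ℚ) ∅ (atomicD X x) = 0 := by
  intro x
  induction x using Finsupp.induction_linear with
  | zero => simp
  | add x y hx hy => simp only [map_add, hx, hy, add_zero]
  | single σ a =>
    rw [← Finsupp.smul_single_one, map_smul, map_smul, atomicD_single, diffGen, map_sum,
      Finset.sum_eq_zero, smul_zero]
    intro i hi
    split_ifs with hc
    · have : σ.erase i ≠ ∅ := by
        intro h0
        have h1 : join X σ ≤ X i := Finset.inf_le hi
        rw [← hc, h0] at h1
        exact hX i (top_le_iff.1 (by simpa [join] using h1))
      simp [this]
    · simp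

variable (X)

/-- Yuzvinsky's relative atomic complex `D_𝒜` of the arrangement `𝒜 = {X i}` of proper subspaces of
`V`, with the order of the atoms given by the order of the index set.  It has the basis `a_σ`,
`σ` a finite set of atoms; `a_∅` is the unit, and the `a_σ` with `σ ≠ ∅` span the augmentation
ideal. -/
noncomputable def relativeAtomicComplex (hX : ∀ i, X i ≠ ⊤) : AugCDGA.{u} where
  carrier := Finset Λ →₀ ℚ
  gr := atomicGr X
  internal := atomic_internal hX
  one := Finsupp.single ∅ 1
  mul := atomicMul X
  d := atomicD X
  aug := Finsupp.lapply ∅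
  one_mem := by
    refine Finsupp.single_mem_supported _ _ ?_
    simp [atomicDeg, join, codim_top]
  mul_mem := atomic_mul_mem hX
  d_mem := atomic_d_mem hX
  one_mul := atomic_one_mul hX
  mul_assoc := atomic_mul_assoc hX
  mul_comm := atomic_mul_comm hX
  d_mul := atomic_d_mul hX
  d_d := atomic_d_d hX
  aug_one := by simp
  aug_mul := atomic_aug_mul hX
  aug_d := atomic_aug_d hX
  aug_gr := by
    intro i x hx hi
    rw [atomicGr, Finsupp.mem_supported] at hx
    by_contra h
    have h1 : (∅ : Finset Λ) ∈ x.support := Finsupp.mem_support_iff.2 h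
    have h2 := hx h1
    simp only [Set.mem_ofPred_eq, atomicDeg, join, Finset.inf_empty, codim_top] at h2
    exact hi (by simpa using h2.symm)

/-- The generator `a_σ`, `σ ≠ ∅`, as a homogeneous element of the augmentation ideal of `D_𝒜`. -/
noncomputable def atomicGen (hX : ∀ i, X i ≠ ⊤) (σ : Finset Λ) (hσ : σ.Nonempty) :
    (relativeAtomicComplex X hX).Hom where
  deg := atomicDeg X σ
  val := Finsupp.single σ (1 : ℚ)
  mem := Finsupp.single_mem_supported (s := {τ | atomicDeg X τ = atomicDeg X σ}) ℚ 1 rfl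
  aug_val := by
    change (Finsupp.single σ (1 : ℚ)) ∅ = 0
    simp [hσ.ne_empty]

end RelativeAtomicComplex

/-! ### Edge colored hypergraphs -/

/-- A hypergraph on the vertices `Fin ℓ` with edges colored by `Λ`, given by the finite set
`C⁻¹(c)` of edges of color `c`, for each `c`.  (The same set of vertices may be an edge of several
colors, as happens for the hypergraph of an arbitrary arrangement embedded in the braid
arrangement.) -/
structure EdgeColoredHypergraph (ℓ : ℕ) (Λ : Type u) where
  edges : Λ → Finset (Finset (Fin ℓ))
  two_le_card : ∀ c, ∀ e ∈ edges c, 2 ≤ e.card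

namespace EdgeColoredHypergraph

variable {ℓ : ℕ} {Λ : Type u}

/-- The subspace `ν(e)` on which the coordinates in `e` agree. -/
def edgeSpace (e : Finset (Fin ℓ)) : Submodule ℂ (Fin ℓ → ℂ) where
  carrier := {v | ∀ i ∈ e, ∀ j ∈ e, v i = v j}
  zero_mem' := fun _ _ _ _ => rfl
  add_mem' := fun ha hb i hi j hj => by
    simp only [Pi.add_apply]; rw [ha i hi j hj, hb i hi j hj]
  smul_mem' := fun c a ha i hi j hj => by
    simp only [Pi.smul_apply]; rw [ha i hi j hj]

/-- Two vertices are linked if they are joined by a sequence of edges in `S`, each meeting the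
next one. -/
def Linked (S : Set (Finset (Fin ℓ))) : Fin ℓ → Fin ℓ → Prop :=
  Relation.EqvGen fun r s => ∃ e ∈ S, r ∈ e ∧ s ∈ e

/-- The vertex sets of the connected components of a set of edges. -/
def componentVerts (S : Set (Finset (Fin ℓ))) : Set (Set (Fin ℓ)) :=
  {U | ∃ e ∈ S, ∃ r ∈ e, U = {s | Linked S r s}}

variable (H : EdgeColoredHypergraph ℓ Λ)

/-- The subspace `X_c` of the color `c`. -/
def space (c : Λ) : Submodule ℂ (Fin ℓ → ℂ) := ⨅ e ∈ H.edges c, edgeSpace e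

/-- The edges `C⁻¹(Γ)` whose color is in `Γ`. -/
def edgesOver (Γ : Finset Λ) : Set (Finset (Fin ℓ)) := {e | ∃ c ∈ Γ, e ∈ H.edges c}

/-- The refinement relation `Γ ⋐ Γ'`: the vertex set of each connected component of `C⁻¹(Γ)` is
contained in the vertex set of a connected component of `C⁻¹(Γ')`. -/
def Refines (Γ Γ' : Finset Λ) : Prop :=
  ∀ U ∈ componentVerts (H.edgesOver Γ), ∃ U' ∈ componentVerts (H.edgesOver Γ'), U ⊆ U'

/-- The subspaces `X_c` form a subspace arrangement: they are proper, and there are no inclusions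
among them (`c ⋐ c'` never holds for different colors). -/
structure IsArrangement : Prop where
  ne_top : ∀ c, H.space c ≠ ⊤
  not_refines : ∀ c c', c ≠ c' → ¬ H.Refines {c} {c'}

variable [LinearOrder Λ]

/-- Multiplicative sets of colors. -/
def Multiplicative (Γ Γ' : Finset Λ) : Prop :=
  codim (join H.space Γ) + codim (join H.space Γ') = codim (join H.space (Γ ∪ Γ'))

/-- `(c₁, c₂, c₃)` is a Massey color system with embedded colors `c₄`, `c₅`. -/
structure IsMasseyColorSystem (c₁ c₂ c₃ c₄ c₅ : Λ) : Prop where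
  mult₁₂ : H.Multiplicative {c₁} {c₂}
  mult₁₂₃ : H.Multiplicative {c₁, c₂} {c₃}
  refines₄ : H.Refines {c₄} {c₁, c₂}
  not_refines₁ : ¬ H.Refines {c₁} {c₂, c₄}
  not_refines₂ : ¬ H.Refines {c₂} {c₁, c₄}
  refines₅ : H.Refines {c₅} {c₂, c₃}
  not_refines₂' : ¬ H.Refines {c₂} {c₃, c₅}
  not_refines₃ : ¬ H.Refines {c₃} {c₂, c₅}

variable {H}

/-- The relative atomic complex `D_𝒜` of the arrangement `𝒜 = {X_c}`, where the atoms are ordered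
like the colors. -/
noncomputable abbrev DA (hA : H.IsArrangement) : AugCDGA.{u} :=
  relativeAtomicComplex H.space hA.ne_top

/-- The generator `a_Γ` of `D_𝒜`, for a non-empty set `Γ` of colors. -/
noncomputable abbrev gen (hA : H.IsArrangement) (Γ : Finset Λ) (hΓ : Γ.Nonempty) : (DA hA).Hom :=
  atomicGen H.space hA.ne_top Γ hΓ

end EdgeColoredHypergraph

/-!
The word `a₁|a₂|a₃` (with `aᵢ = a_{cᵢ}`) is completed to an approximate cycle by a defining system
for the triple Massey product of `a₁`, `a₂`, `a₃`.

Refinement of colors is the reverse inclusion of intersections (`refines_iff`).  Hence the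
hypotheses on the embedded color `c₄` say that `X₁₂₄ = X₁₂`, while dropping `c₁` or `c₂` from
`{c₁, c₂, c₄}` enlarges the intersection.  As `c₄` is the largest of the three colors, this gives
`d a₁₂₄ = -a₁₂`, and in the same way `d a₂₃₅ = -a₂₃` (`gen_triple_d`).  By subadditivity of the
codimension all splittings of `{c₁, c₂, c₃}` are multiplicative, so `a₁a₂ = a₁₂` and `a₂a₃ = a₂₃`.
The generators `a₁`, `a₂`, `a₃` are cycles of odd degree, so

`D (a₁|a₂|a₃) = -a₁₂|a₃ - a₁|a₂₃`,

and subtracting `a₁₂₄|a₃ + a₁|a₂₃₅`, an element of filtration `1`, cancels the right-hand side.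
What is left is the contraction of the correction terms (`D_bar_sub_sub`),

`D (a₁|a₂|a₃ - a₁₂₄|a₃ - a₁|a₂₃₅) = a₁₂₄a₃ + a₁a₂₃₅ = a₁₂₃₅ - a₁₂₃₄`,

where the sign of `a₁₂₃₄` comes from sorting `c₁, c₂, c₄, c₃`.  This element has filtration `0`,
so it represents `d₂` (`exists_represents_of_D_eq`).
-/

/-! ### Signs -/

lemma koszul_eq_zero_of_strictMonoOn {f : ℕ → ℕ} {S : Finset ℕ} (ε : ℕ → ZMod 2)
    (hf : StrictMonoOn f S) : koszul f S ε = 0 :=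
  Finset.sum_eq_zero fun _ hx => Finset.sum_eq_zero fun _ hy =>
    if_neg fun h => (hf hx hy h.1).not_gt h.2

/-! ### The differential on words of length at most three -/

namespace AugCDGA

variable {W : AugCDGA.{u}}

/-- The labelled tree `0 → 1 → ⋯ → n` whose class in `𝔼(s⁻¹ W̄)` is the word `a₀|a₁|⋯|aₙ`. -/
def longGen {n : ℕ} (a : Fin (n + 1) → W.Hom) : W.Gen :=
  ⟨Finset.range (n + 1), longEdges n, fun v => a (Fin.ofNat (n + 1) v), isDirTree_long n⟩

lemma bar_mem_F {n : ℕ} (a : Fin (n + 1) → W.Hom) {p : ℤ} (hp : (n : ℤ) ≤ p) :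
    bar a ∈ W.sinhaWalter.F p := by
  change (longGen a).cls ∈ W.colFilt p
  exact Submodule.subset_span ⟨longGen a, by simpa [longGen, longEdges] using hp, rfl⟩

/-- The labels enter a word only through their degrees and, linearly, through their values. -/
lemma bar_eq_smul {n : ℕ} {a b : Fin (n + 1) → W.Hom} (i : Fin (n + 1)) (r : ℚ)
    (h : ∀ j ≠ i, b j = a j) (hdeg : (b i).deg = (a i).deg)
    (hval : (b i).val = r • (a i).val) : bar b = r • bar a := by
  have hi : Fin.ofNat (n + 1) (i : ℕ) = i := Fin.ofNat_val_eq_self i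
  refine cls_smul (g := longGen a) (g'' := longGen b) (i : ℕ) r (Finset.mem_range.2 i.2) rfl rfl
    (fun v hv hvi => h _ fun hv' => hvi ?_) ?_ ?_
  · rw [← hv', Fin.val_ofNat, Nat.mod_eq_of_lt (Finset.mem_range.1 hv)]
  · simpa only [longGen, hi] using hdeg
  · simpa only [longGen, hi] using hval

lemma bar_eq_zero {n : ℕ} {a : Fin (n + 1) → W.Hom} (i : Fin (n + 1)) (h : (a i).val = 0) :
    bar a = 0 :=
  (bar_eq_smul (a := a) (b := a) i 0 (fun _ _ => rfl) rfl (by simp [h])).trans (zero_smul ℚ _)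

/-- An order preserving renumbering of the vertices produces no Koszul sign. -/
lemma cls_eq_of_strictMonoOn {g g' : W.Gen} (f : ℕ → ℕ) (hf : StrictMonoOn f g.verts)
    (hverts : g'.verts = g.verts.image f) (hedges : g'.edges = g.edges.map (Prod.map f f))
    (hlab : ∀ v ∈ g.verts, g'.lab (f v) = g.lab v) : g.cls = g'.cls := by
  have h := cls_perm (W := W) ⟨hf.injOn, hverts, hedges, hlab⟩
  rwa [koszul_eq_zero_of_strictMonoOn _ hf, sgn_zero, one_smul] at h

lemma dWGen_three (a b c : W.Hom) :
    dWGen (longGen ![a, b, c]) = (longGen ![a.d, b, c]).cls +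
      sgn a.par • (longGen ![a, b.d, c]).cls +
      sgn (a.par + b.par) • (longGen ![a, b, c.d]).cls := by
  have hV : (longGen ![a, b, c]).verts = {0, 1, 2} := rfl
  have key : ∀ (x : ℕ) (w : Fin 3 → W.Hom),
      (∀ v : Fin 3, w v = ((longGen ![a, b, c]).diff x).lab v) →
      ((longGen ![a, b, c]).diff x).cls = (longGen w).cls := by
    intro x w hw
    refine cls_congr rfl rfl fun v hv => ?_
    have hv' : v < 3 := Finset.mem_range.1 hv
    refine (hw _).trans ?_
    rw [Fin.val_ofNat, Nat.mod_eq_of_lt hv']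
  rw [dWGen, hV, Finset.sum_insert (by decide), Finset.sum_insert (by decide),
    Finset.sum_singleton, key 0 ![a.d, b, c] (by intro v; fin_cases v <;> rfl),
    key 1 ![a, b.d, c] (by intro v; fin_cases v <;> rfl),
    key 2 ![a, b, c.d] (by intro v; fin_cases v <;> rfl), ← add_assoc]
  have e0 : (longGen ![a, b, c]).ε 0 = a.par := rfl
  have e1 : (longGen ![a, b, c]).ε 1 = b.par := rfl
  simp [before_eq, ltInd, sgn_zero, e0, e1]

lemma dWGen_two (a b : W.Hom) :
    dWGen (longGen ![a, b]) =
      (longGen ![a.d, b]).cls + sgn a.par • (longGen ![a, b.d]).cls := by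
  have hV : (longGen ![a, b]).verts = {0, 1} := rfl
  have key : ∀ (x : ℕ) (w : Fin 2 → W.Hom),
      (∀ v : Fin 2, w v = ((longGen ![a, b]).diff x).lab v) →
      ((longGen ![a, b]).diff x).cls = (longGen w).cls := by
    intro x w hw
    refine cls_congr rfl rfl fun v hv => ?_
    have hv' : v < 2 := Finset.mem_range.1 hv
    refine (hw _).trans ?_
    rw [Fin.val_ofNat, Nat.mod_eq_of_lt hv']
  rw [dWGen, hV, Finset.sum_insert (by decide),
    Finset.sum_singleton, key 0 ![a.d, b] (by intro v; fin_cases v <;> rfl),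
    key 1 ![a, b.d] (by intro v; fin_cases v <;> rfl)]
  have e0 : (longGen ![a, b]).ε 0 = a.par := rfl
  simp [before_eq, ltInd, sgn_zero, e0]

lemma dMuGen_three (a b c : W.Hom) :
    dMuGen (longGen ![a, b, c]) = sgn (a.par + 1) • (longGen ![a.mul b, c]).cls +
      sgn (a.par + b.par + 1) • (longGen ![a, b.mul c]).cls := by
  have hV : (longGen ![a, b, c]).verts = {0, 1, 2} := rfl
  have hE : (longGen ![a, b, c]).edges = {(0, 1), (1, 2)} := rfl
  have e0 : (longGen ![a, b, c]).ε 0 = a.par := rfl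
  have e1 : (longGen ![a, b, c]).ε 1 = b.par := rfl
  have e2 : (longGen ![a, b, c]).ε 2 = c.par := rfl
  have h01 : ((0, 1) : ℕ × ℕ) ∈ (longGen ![a, b, c]).edges := by rw [hE]; decide
  have h12 : ((1, 2) : ℕ × ℕ) ∈ (longGen ![a, b, c]).edges := by rw [hE]; decide
  rw [dMuGen, show (longGen ![a, b, c]).edges.map (muE (longGen ![a, b, c])) =
      {muE (longGen ![a, b, c]) (0, 1), muE (longGen ![a, b, c]) (1, 2)} from rfl,
    Multiset.insert_eq_cons, Multiset.sum_cons, Multiset.sum_singleton,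
    muE_of_mem h01, muE_of_mem h12, hV]
  congr 1
  · congr 1
    · rw [muSign, show ({0, 1, 2} : Finset ℕ).erase 0 = {1, 2} from rfl,
        show ({0, 1, 2} : Finset ℕ).erase 1 = {0, 2} from rfl]
      simp [before_eq, ltInd, e0]
    · refine cls_eq_of_strictMonoOn (fun v => v - 1) ?_ rfl rfl ?_
      · change StrictMonoOn _ (({0, 2} : Finset ℕ) : Set ℕ)
        intro x hx y hy hxy
        simp at hx hy
        dsimp only
        omega
      · change ∀ v ∈ ({0, 2} : Finset ℕ), _
        intro v hv
        rcases (by simpa using hv : v = 0 ∨ v = 2) with rfl | rfl <;> rfl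
  · congr 1
    · rw [muSign, show ({0, 1, 2} : Finset ℕ).erase 1 = {0, 2} from rfl,
        show ({0, 1, 2} : Finset ℕ).erase 2 = {0, 1} from rfl]
      refine congrArg sgn ?_
      simp [before_eq, ltInd, e0, e1, e2]
      linear_combination (b.par * a.par + c.par * a.par) * zmod2_two
    · refine cls_eq_of_strictMonoOn id strictMonoOn_id rfl rfl ?_
      change ∀ v ∈ ({0, 1} : Finset ℕ), _
      intro v hv
      rcases (by simpa using hv : v = 0 ∨ v = 1) with rfl | rfl <;> rfl

lemma dMuGen_two (a b : W.Hom) :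
    dMuGen (longGen ![a, b]) = sgn (a.par + 1) • (longGen ![a.mul b]).cls := by
  have hV : (longGen ![a, b]).verts = {0, 1} := rfl
  have e0 : (longGen ![a, b]).ε 0 = a.par := rfl
  have h01 : ((0, 1) : ℕ × ℕ) ∈ (longGen ![a, b]).edges := by
    rw [show (longGen ![a, b]).edges = {(0, 1)} from rfl]; decide
  rw [dMuGen, show (longGen ![a, b]).edges.map (muE (longGen ![a, b])) =
      {muE (longGen ![a, b]) (0, 1)} from rfl, Multiset.sum_singleton, muE_of_mem h01, hV]
  congr 1
  · rw [muSign, show ({0, 1} : Finset ℕ).erase 0 = {1} from rfl,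
      show ({0, 1} : Finset ℕ).erase 1 = {0} from rfl]
    simp [before_eq, ltInd, e0]
  · refine cls_eq_of_strictMonoOn id strictMonoOn_id rfl rfl ?_
    change ∀ v ∈ ({0} : Finset ℕ), _
    intro v hv
    obtain rfl : v = 0 := by simpa using hv
    rfl

lemma D_bar_three (a b c : W.Hom) :
    W.sinhaWalter.D (bar ![a, b, c]) =
      bar ![a.d, b, c] + sgn a.par • bar ![a, b.d, c] +
        sgn (a.par + b.par) • bar ![a, b, c.d] +
      (sgn (a.par + 1) • bar ![a.mul b, c] + sgn (a.par + b.par + 1) • bar ![a, b.mul c]) :=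
  congrArg₂ (· + ·) ((dW_cls _).trans (dWGen_three a b c)) ((dMu_cls _).trans (dMuGen_three a b c))

lemma D_bar_two (a b : W.Hom) :
    W.sinhaWalter.D (bar ![a, b]) =
      bar ![a.d, b] + sgn a.par • bar ![a, b.d] + sgn (a.par + 1) • bar ![a.mul b] :=
  congrArg₂ (· + ·) ((dW_cls _).trans (dWGen_two a b)) ((dMu_cls _).trans (dMuGen_two a b))

/-- The defining system of a Massey product: if `a`, `b`, `c` are cycles and `d u = -ab`,
`d v = -bc`, then the correction terms `u|c` and `a|v` of lower filtration turn `a|b|c` into an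
element whose total differential is concentrated in filtration `0`.  The desuspended labels `a`,
`b`, `u` are taken even, so that moving past them produces no signs. -/
lemma D_bar_sub_sub {a b c u v ab bc : W.Hom}
    (ha : a.par = 0) (hb : b.par = 0) (hu : u.par = 0)
    (hda : a.d.val = 0) (hdb : b.d.val = 0) (hdc : c.d.val = 0)
    (habdeg : (a.mul b).deg = ab.deg) (hab : (a.mul b).val = ab.val)
    (hbcdeg : (b.mul c).deg = bc.deg) (hbc : (b.mul c).val = bc.val)
    (hudeg : u.d.deg = ab.deg) (hud : u.d.val = (-1 : ℚ) • ab.val)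
    (hvdeg : v.d.deg = bc.deg) (hvd : v.d.val = (-1 : ℚ) • bc.val) :
    W.sinhaWalter.D (bar ![a, b, c] - bar ![u, c] - bar ![a, v]) =
      bar ![u.mul c] + bar ![a.mul v] := by
  rw [map_sub, map_sub, D_bar_three, D_bar_two, D_bar_two, ha, hb, hu,
    bar_eq_zero (a := ![a.d, b, c]) 0 hda, bar_eq_zero (a := ![a, b.d, c]) 1 hdb,
    bar_eq_zero (a := ![a, b, c.d]) 2 hdc, bar_eq_zero (a := ![u, c.d]) 1 hdc,
    bar_eq_zero (a := ![a.d, v]) 0 hda,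
    bar_eq_smul (a := ![ab, c]) (b := ![a.mul b, c]) 0 1
      (by intro j hj; fin_cases j <;> first | exact absurd rfl hj | rfl)
      habdeg (hab.trans (one_smul ℚ _).symm),
    bar_eq_smul (a := ![a, bc]) (b := ![a, b.mul c]) 1 1
      (by intro j hj; fin_cases j <;> first | exact absurd rfl hj | rfl)
      hbcdeg (hbc.trans (one_smul ℚ _).symm),
    bar_eq_smul (a := ![ab, c]) (b := ![u.d, c]) 0 (-1)
      (by intro j hj; fin_cases j <;> first | exact absurd rfl hj | rfl) hudeg hud,
    bar_eq_smul (a := ![a, bc]) (b := ![a, v.d]) 1 (-1)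
      (by intro j hj; fin_cases j <;> first | exact absurd rfl hj | rfl) hvdeg hvd]
  simp only [add_zero, zero_add, sgn_zero, sgn_one]
  module

end AugCDGA

/-! ### Refinement of colors and inclusions of subspaces -/

namespace EdgeColoredHypergraph

variable {ℓ : ℕ} {Λ : Type u} (H : EdgeColoredHypergraph ℓ Λ)

lemma mem_join_space [LinearOrder Λ] {Γ : Finset Λ} {v : Fin ℓ → ℂ} :
    v ∈ join H.space Γ ↔ ∀ i j, Linked (H.edgesOver Γ) i j → v i = v j := by
  have h : v ∈ join H.space Γ ↔
      ∀ e ∈ H.edgesOver Γ, ∀ i ∈ e, ∀ j ∈ e, v i = v j := by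
    simp only [join, Submodule.mem_finsetInf, space, Submodule.mem_iInf, edgesOver]
    exact ⟨fun h e ⟨c, hc, he⟩ => h c hc e he, fun h c hc e he => h e ⟨c, hc, he⟩⟩
  rw [h]
  refine ⟨fun h i j hij => ?_, fun h e he i hi j hj => h i j (.rel _ _ ⟨e, he, hi, hj⟩)⟩
  induction hij with
  | rel i j hij => obtain ⟨e, he, hi, hj⟩ := hij; exact h e he i hi j hj
  | refl => rfl
  | symm _ _ _ ih => exact ih.symm
  | trans _ _ _ _ _ ih ih' => exact ih.trans ih'

lemma Linked.eq_or_mem_edge {S : Set (Finset (Fin ℓ))} {r s : Fin ℓ} (h : Linked S r s) :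
    r = s ∨ (∃ e ∈ S, r ∈ e) ∧ ∃ e ∈ S, s ∈ e := by
  induction h with
  | rel r s h => obtain ⟨e, he, hr, hs⟩ := h; exact .inr ⟨⟨e, he, hr⟩, e, he, hs⟩
  | refl => exact .inl rfl
  | symm _ _ _ ih => exact ih.imp Eq.symm And.symm
  | trans _ _ _ _ _ ih ih' =>
    rcases ih with rfl | ih
    · exact ih'
    · rcases ih' with rfl | ih'
      · exact .inr ih
      · exact .inr ⟨ih.1, ih'.2⟩

/-- The relation `Γ ⋐ Γ'` is the reverse inclusion of the intersections `X_Γ' ≤ X_Γ`.  For the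
converse, the indicator function of a class of linked vertices is tested against the inclusion. -/
lemma refines_iff [LinearOrder Λ] {Γ Γ' : Finset Λ} :
    H.Refines Γ Γ' ↔ join H.space Γ' ≤ join H.space Γ := by
  classical
  constructor
  · intro h v hv
    rw [mem_join_space] at hv ⊢
    intro i j hij
    rcases hij.eq_or_mem_edge with rfl | ⟨⟨e, he, hi⟩, -⟩
    · rfl
    · obtain ⟨U', ⟨e', he', r, hr, rfl⟩, hU⟩ := h _ ⟨e, he, i, hi, rfl⟩
      exact (hv r i (hU (.refl _))).symm.trans (hv r j (hU hij))
  · rintro h _ ⟨e, he, r, hr, rfl⟩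
    let v : Fin ℓ → ℂ := fun s => if Linked (H.edgesOver Γ') r s then 1 else 0
    have hv : v ∈ join H.space Γ' := (H.mem_join_space).2 fun i j hij => by
      have : Linked (H.edgesOver Γ') r i ↔ Linked (H.edgesOver Γ') r j :=
        ⟨fun h => .trans _ _ _ h hij, fun h => .trans _ _ _ h (.symm _ _ hij)⟩
      simp only [v, this]
    have key : ∀ s, Linked (H.edgesOver Γ) r s → Linked (H.edgesOver Γ') r s := by
      intro s hs
      have hrs := (H.mem_join_space).1 (h hv) r s hs
      by_contra hcon
      simp [v, hcon, show Linked (H.edgesOver Γ') r r from .refl _] at hrs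
    -- As `e` has a second vertex, the vertex `r` lies on an edge over `Γ'`.
    obtain ⟨c, -, hc⟩ := id he
    obtain ⟨s, hs, hsr⟩ := Finset.exists_mem_ne (H.two_le_card c e hc) r
    rcases (key s (.rel _ _ ⟨e, he, hr, hs⟩)).eq_or_mem_edge with hrs | ⟨⟨e', he', hr'⟩, -⟩
    · exact absurd hrs.symm hsr
    · exact ⟨_, ⟨e', he', r, hr', rfl⟩, key⟩

end EdgeColoredHypergraph

/-! ### Products and differentials of generators -/

section RelativeAtomicComplex

variable {V : Type*} [AddCommGroup V] [Module ℂ V] [FiniteDimensional ℂ V]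
  {Λ : Type u} [LinearOrder Λ] {X : Λ → Submodule ℂ V}

lemma shufflePar_eq_zero {σ τ : Finset Λ} (h : ∀ s ∈ σ, ∀ t ∈ τ, s < t) : shufflePar σ τ = 0 :=
  Finset.sum_eq_zero fun s hs => Finset.sum_eq_zero fun t ht => if_neg (h s hs t ht).not_gt

lemma atomicGen_par (hX : ∀ i, X i ≠ ⊤) {σ : Finset Λ} (hσ : σ.Nonempty) :
    (atomicGen X hX σ hσ).par = σ.card + 1 := by
  have h : (atomicGen X hX σ hσ).par = ((2 * codim (join X σ) - σ.card - 1 : ℤ) : ZMod 2) := rfl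
  rw [h]
  push_cast
  rw [zmod2_two]
  grind

lemma atomicGen_mul_val (hX : ∀ i, X i ≠ ⊤) {σ τ ρ : Finset Λ} (hσ : σ.Nonempty)
    (hτ : τ.Nonempty) (hρ : ρ.Nonempty) (hστ : σ ∪ τ = ρ)
    (h : codim (join X σ) + codim (join X τ) = codim (join X (σ ∪ τ))) :
    ((atomicGen X hX σ hσ).mul (atomicGen X hX τ hτ)).val =
      sgn (shufflePar σ τ) • (atomicGen X hX ρ hρ).val := by
  subst hστ
  refine (atomicMul_single X σ τ).trans ?_
  rw [mulGen, if_pos h]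
  rfl

lemma atomicGen_mul_deg (hX : ∀ i, X i ≠ ⊤) {σ τ ρ : Finset Λ} (hσ : σ.Nonempty)
    (hτ : τ.Nonempty) (hρ : ρ.Nonempty) (hστ : σ ∪ τ = ρ)
    (h : codim (join X σ) + codim (join X τ) = codim (join X (σ ∪ τ))) :
    ((atomicGen X hX σ hσ).mul (atomicGen X hX τ hτ)).deg = (atomicGen X hX ρ hρ).deg := by
  subst hστ
  have hc := Finset.card_union_of_disjoint (disjoint_of_mult hX h)
  change atomicDeg X σ + atomicDeg X τ = atomicDeg X (σ ∪ τ)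
  simp only [atomicDeg, ← h, hc]
  push_cast
  ring

lemma atomicGen_singleton_d_val (hX : ∀ i, X i ≠ ⊤) (i : Λ) :
    (atomicGen X hX {i} (Finset.singleton_nonempty i)).d.val = 0 := by
  refine (atomicD_single X {i}).trans ?_
  simp only [diffGen, Finset.sum_singleton, Finset.erase_singleton, join, Finset.inf_empty,
    Finset.inf_singleton, (hX i).symm, if_false]
  rfl

/-- If `m` is the only element of `σ` which can be dropped without changing the intersection, and
it is the last one, then `d a_σ` is, up to sign, the generator without `m`. -/
lemma atomicGen_d_val (hX : ∀ i, X i ≠ ⊤) {σ τ : Finset Λ} (hσ : σ.Nonempty) (hτ : τ.Nonempty)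
    {m : Λ} (hm : m ∈ σ) (hτm : σ.erase m = τ) (hmax : ∀ i ∈ σ, i ≤ m)
    (hdrop : join X τ = join X σ) (h : ∀ i ∈ τ, join X (σ.erase i) ≠ join X σ) :
    (atomicGen X hX σ hσ).d.val = sgn σ.card • (atomicGen X hX τ hτ).val := by
  subst hτm
  refine (atomicD_single X σ).trans ?_
  rw [diffGen, Finset.sum_eq_single_of_mem m hm fun i hi him =>
    if_neg (h i (Finset.mem_erase.2 ⟨him, hi⟩)), if_pos hdrop]
  have hpos : posPar σ m = σ.card := by
    simp [posPar, Finset.filter_true_of_mem hmax]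
  rw [hpos]
  rfl

lemma atomicGen_d_deg (hX : ∀ i, X i ≠ ⊤) {σ τ : Finset Λ} (hσ : σ.Nonempty) (hτ : τ.Nonempty)
    {m : Λ} (hm : m ∈ σ) (hτm : σ.erase m = τ) (hdrop : join X τ = join X σ) :
    (atomicGen X hX σ hσ).d.deg = (atomicGen X hX τ hτ).deg := by
  subst hτm
  change atomicDeg X σ + 1 = atomicDeg X (σ.erase m)
  simp only [atomicDeg, hdrop, ← Finset.card_erase_add_one hm]
  push_cast
  ring

end RelativeAtomicComplex

/-! ### The second differential of a filtered complex -/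

namespace FilteredComplex

/-- The differential `d₂` is computed by a correction `y` of lower filtration. -/
lemma exists_represents_of_D_eq {C : FilteredComplex.{u}} {x y z : C.carrier}
    (hy : y ∈ C.F 1) (hx : x ∈ C.F 2) (hz : z ∈ C.F 0) (h : C.D (x - y) = z) :
    ∃ ξ : C.E 2 2, Represents 2 2 x ξ ∧ Represents 2 0 z (C.d 2 2 ξ) := by
  have hmem : x - y ∈ C.Z 2 2 :=
    ⟨sub_mem hx (C.mono (by norm_num) hy), (by rw [h]; exact hz : C.D (x - y) ∈ C.F 0)⟩
  refine ⟨Submodule.Quotient.mk ⟨x - y, hmem⟩, ⟨⟨x - y, hmem⟩, ?_, rfl⟩,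
    ⟨C.D (x - y), D_mem_Z hmem⟩, ?_, rfl⟩
  · change x - (x - y) ∈ C.F 1
    rwa [sub_sub_cancel]
  · change z - C.D (x - y) ∈ _
    rw [h, sub_self]
    exact zero_mem _

end FilteredComplex

/-! ### The second differential of a Massey color system -/

namespace EdgeColoredHypergraph

variable {ℓ : ℕ} {Λ : Type u} [LinearOrder Λ] {H : EdgeColoredHypergraph ℓ Λ}

/-- Multiplicativity depends on a set of colors only through the intersection `X_σ`. -/
lemma Multiplicative.congr_left {σ τ ρ : Finset Λ} (h : H.Multiplicative σ τ)
    (hρ : join H.space ρ = join H.space σ) :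
    H.Multiplicative ρ τ := by
  rw [EdgeColoredHypergraph.Multiplicative, join_union, hρ, ← join_union]
  exact h

lemma Multiplicative.symm {σ τ : Finset Λ} (h : H.Multiplicative σ τ) : H.Multiplicative τ σ := by
  rw [EdgeColoredHypergraph.Multiplicative, Finset.union_comm, add_comm]
  exact h

/-- Multiplicativity of three sets of colors does not depend on the bracketing: by subadditivity,
`codim X_{σ ∪ τ ∪ ρ} = codim X_σ + codim X_τ + codim X_ρ` forces equality in both estimates. -/
lemma Multiplicative.assoc {σ τ ρ : Finset Λ} (h : H.Multiplicative σ τ)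
    (h' : H.Multiplicative (σ ∪ τ) ρ) :
    H.Multiplicative τ ρ ∧ H.Multiplicative σ (τ ∪ ρ) := by
  have h₁ := codim_join_union_le (X := H.space) τ ρ
  have h₂ := codim_join_union_le (X := H.space) σ (τ ∪ ρ)
  unfold EdgeColoredHypergraph.Multiplicative at *
  rw [Finset.union_assoc] at h'
  omega

/-- If a third color `c` satisfies `{c} ⋐ {a, b}`, while neither `{a} ⋐ {b, c}` nor
`{b} ⋐ {a, c}`, then `c` is the only color which can be dropped from `{a, b, c}`.  Hence
`d a_{abc} = -a_{ab}`. -/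
lemma gen_triple_d (hA : H.IsArrangement) {a b c : Λ} (hab : a < b) (hbc : b < c)
    (hc : H.Refines {c} {a, b}) (ha : ¬ H.Refines {a} {b, c}) (hb : ¬ H.Refines {b} {a, c}) :
    join H.space {a, b, c} = join H.space {a, b} ∧
      (gen hA {a, b, c} (Finset.insert_nonempty _ _)).d.deg =
        (gen hA {a, b} (Finset.insert_nonempty _ _)).deg ∧
      (gen hA {a, b, c} (Finset.insert_nonempty _ _)).d.val =
        (-1 : ℚ) • (gen hA {a, b} (Finset.insert_nonempty _ _)).val := by
  rw [refines_iff] at hc ha hb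
  have hac := hab.trans hbc
  have ec : ({a, b, c} : Finset Λ).erase c = {a, b} := by
    grind
  have ea : ({a, b, c} : Finset Λ).erase a = {b, c} := by
    grind
  have eb : ({a, b, c} : Finset Λ).erase b = {a, c} := by
    grind
  have hj : join H.space {a, b, c} = join H.space {a, b} := by
    rw [show ({a, b, c} : Finset Λ) = {a, b} ∪ {c} by grind, join_union]
    exact inf_eq_left.2 hc
  refine ⟨hj, atomicGen_d_deg _ _ _ (by simp) ec hj.symm, ?_⟩
  have hcard : ((({a, b, c} : Finset Λ).card : ℕ) : ZMod 2) = 1 := by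
    rw [Finset.card_eq_three.2 ⟨a, b, c, hab.ne, hac.ne, hbc.ne, rfl⟩]
    rfl
  have h := atomicGen_d_val hA.ne_top (σ := {a, b, c}) (Finset.insert_nonempty _ _)
    (Finset.insert_nonempty _ _) (m := c) (by simp) ec (by simp [hbc.le, hac.le])
    hj.symm ?_
  · rwa [hcard, sgn_one] at h
  · intro i hi h
    rcases (by simpa using hi : i = a ∨ i = b) with h' | h'
    · rw [h', ea] at h
      exact ha (h.le.trans (join_anti (X := H.space) (σ := {a}) (τ := {a, b, c}) (by simp)))
    · rw [h', eb] at h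
      exact hb (h.le.trans (join_anti (X := H.space) (σ := {b}) (τ := {a, b, c}) (by simp)))

end EdgeColoredHypergraph

open AugCDGA FilteredComplex EdgeColoredHypergraph in
theorem theorem4p6 {ℓ : ℕ} {Λ : Type*} [Finite Λ] [LinearOrder Λ]
    (H : EdgeColoredHypergraph ℓ Λ) (hA : H.IsArrangement) (c₁ c₂ c₃ c₄ c₅ : Λ)
    (hM : H.IsMasseyColorSystem c₁ c₂ c₃ c₄ c₅)
    (h₁₂ : c₁ < c₂) (h₂₃ : c₂ < c₃) (h₃₄ : c₃ < c₄) (h₄₅ : c₄ < c₅) :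
    ∃ ξ : (DA hA).sinhaWalter.E 2 2,
      Represents 2 2
        (bar ![gen hA {c₁} (Finset.singleton_nonempty _), gen hA {c₂} (Finset.singleton_nonempty _),
          gen hA {c₃} (Finset.singleton_nonempty _)]) ξ ∧
      Represents 2 0
        (bar ![gen hA {c₁, c₂, c₃, c₅} (Finset.insert_nonempty _ _)] -
          bar ![gen hA {c₁, c₂, c₃, c₄} (Finset.insert_nonempty _ _)])
        ((DA hA).sinhaWalter.d 2 2 ξ) := by
  have m₁₂ := hM.mult₁₂
  obtain ⟨m₂₃, m₁₂₃⟩ := Multiplicative.assoc hM.mult₁₂ hM.mult₁₂₃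
  obtain ⟨hj₄, hdeg₄, hval₄⟩ := gen_triple_d hA h₁₂ (h₂₃.trans h₃₄) hM.refines₄
    hM.not_refines₁ hM.not_refines₂
  obtain ⟨hj₅, hdeg₅, hval₅⟩ := gen_triple_d hA h₂₃ (h₃₄.trans h₄₅) hM.refines₅
    hM.not_refines₂' hM.not_refines₃
  have m₄ : H.Multiplicative {c₁, c₂, c₄} {c₃} := hM.mult₁₂₃.congr_left hj₄
  have m₅ : H.Multiplicative {c₁} {c₂, c₃, c₅} := (m₁₂₃.symm.congr_left hj₅).symm
  have hu₄ : ({c₁, c₂, c₄} : Finset Λ) ∪ {c₃} = {c₁, c₂, c₃, c₄} := by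
    grind
  have s₁₂ : shufflePar {c₁} {c₂} = 0 := shufflePar_eq_zero (by simpa)
  have s₂₃ : shufflePar {c₂} {c₃} = 0 := shufflePar_eq_zero (by simpa)
  -- Sorting `c₁, c₂, c₄, c₃` takes one transposition, whence the sign of `a_{1234}`.
  have s₄ : shufflePar {c₁, c₂, c₄} {c₃} = 1 := by
    simp only [shufflePar, Finset.sum_singleton]
    rw [Finset.sum_insert (by grind), Finset.sum_pair (by grind), if_neg (by order),
      if_neg (by order), if_pos h₃₄, zero_add, zero_add]
  have s₅ : shufflePar {c₁} {c₂, c₃, c₅} = 0 := shufflePar_eq_zero (by grind)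
  have par₁ : ∀ c : Λ, (gen hA {c} (Finset.singleton_nonempty c)).par = 0 := fun c => by
    rw [atomicGen_par, Finset.card_singleton]; rfl
  have par₄ : (gen hA {c₁, c₂, c₄} (Finset.insert_nonempty _ _)).par = 0 := by
    rw [atomicGen_par, Finset.card_eq_three.2 ⟨c₁, c₂, c₄, h₁₂.ne,
      (h₁₂.trans (h₂₃.trans h₃₄)).ne, (h₂₃.trans h₃₄).ne, rfl⟩]; rfl
  have hD := D_bar_sub_sub (ab := gen hA {c₁, c₂} (Finset.insert_nonempty _ _))
    (bc := gen hA {c₂, c₃} (Finset.insert_nonempty _ _)) (par₁ c₁) (par₁ c₂) par₄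
    (atomicGen_singleton_d_val hA.ne_top c₁) (atomicGen_singleton_d_val hA.ne_top c₂)
    (atomicGen_singleton_d_val hA.ne_top c₃)
    (atomicGen_mul_deg hA.ne_top _ _ (Finset.insert_nonempty _ _) rfl m₁₂)
    ((atomicGen_mul_val hA.ne_top _ _ (Finset.insert_nonempty _ _) rfl m₁₂).trans
      (by rw [s₁₂, sgn_zero]; exact one_smul ℚ _))
    (atomicGen_mul_deg hA.ne_top _ _ (Finset.insert_nonempty _ _) rfl m₂₃)
    ((atomicGen_mul_val hA.ne_top _ _ (Finset.insert_nonempty _ _) rfl m₂₃).trans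
      (by rw [s₂₃, sgn_zero]; exact one_smul ℚ _))
    hdeg₄ hval₄ hdeg₅ hval₅
  have hprod₄ := bar_eq_smul
    (a := ![gen hA {c₁, c₂, c₃, c₄} (Finset.insert_nonempty _ _)])
    (b := ![(gen hA {c₁, c₂, c₄} (Finset.insert_nonempty _ _)).mul
      (gen hA {c₃} (Finset.singleton_nonempty _))]) 0 (-1)
    (fun j hj => absurd (Fin.fin_one_eq_zero j) hj)
    (atomicGen_mul_deg hA.ne_top _ _ (Finset.insert_nonempty _ _) hu₄ m₄)
    ((atomicGen_mul_val hA.ne_top _ _ (Finset.insert_nonempty _ _) hu₄ m₄).trans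
      (by rw [s₄, sgn_one]; rfl))
  have hprod₅ := bar_eq_smul
    (a := ![gen hA {c₁, c₂, c₃, c₅} (Finset.insert_nonempty _ _)])
    (b := ![(gen hA {c₁} (Finset.singleton_nonempty _)).mul
      (gen hA {c₂, c₃, c₅} (Finset.insert_nonempty _ _))]) 0 1
    (fun j hj => absurd (Fin.fin_one_eq_zero j) hj)
    (atomicGen_mul_deg hA.ne_top _ _ (Finset.insert_nonempty _ _) rfl m₅)
    ((atomicGen_mul_val hA.ne_top _ _ (Finset.insert_nonempty _ _) rfl m₅).trans
      (by rw [s₅, sgn_zero]; rfl))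
  rw [hprod₄, hprod₅, sub_sub, neg_one_smul, one_smul, neg_add_eq_sub] at hD
  refine exists_represents_of_D_eq ?_ ?_ ?_ hD
  · exact add_mem (bar_mem_F _ le_rfl) (bar_mem_F _ le_rfl)
  · exact bar_mem_F _ le_rfl
  · exact sub_mem (bar_mem_F _ le_rfl) (bar_mem_F _ le_rfl)
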